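/- Let $G$ be a finite soluble group which is 2-generated, i.e. $G=\langle a,b\rangle$ for some $a,b\in G$, not necessarily distinct. Let $\Gamma(G)$ be the generating graph of $G$: the simple graph whose vertices are the nonidentity elements of $G$ and in which two distinct vertices $g_1,g_2$ are adjacent if and only if $\langle g_1,g_2\rangle=G$. Let $\Delta(G)$ be the subgraph of $\Gamma(G)$ induced by the non-isolated vertices, i.e. by those vertices that are adjacent to some vertex. Then $\Delta(G)$ is connected and has diameter at most $3$: any two vertices of $\Delta(G)$ are joined by a path in $\Delta(G)$ of length at most $3$. (If $|G|\le 2$, then $\Delta(G)$ has no vertices, and the empty graph is counted as connected; if $|G|>2$, then $\Delta(G)$ is nonempty.) Moreover, whenever $a_1,b_1,a_2,b_2\in G$ satisfy $\langle a_1,b_1\rangle=\langle a_2,b_2\rangle=G$, there exist $c_1,c_2\in G$ with $\langle a_1,c_1\rangle=\langle c_1,c_2\rangle=\langle c_2,a_2\rangle=G$. -/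

import Mathlib

/-- A group is 2-generated if some two (not necessarily distinct) elements generate it. -/
def IsTwoGenerated (G : Type*) [Group G] : Prop :=
  ∃ a b : G, Subgroup.closure {a, b} = ⊤

/-- The generating graph: the vertices are the nonidentity elements of `G`, and two distinct
vertices are adjacent if they generate `G`. -/
def generatingGraph (G : Type*) [Group G] : SimpleGraph {g : G // g ≠ 1} where
  Adj x y := x ≠ y ∧ Subgroup.closure {(x : G), (y : G)} = ⊤
  symm := ⟨fun _ _ h => ⟨h.1.symm, by rw [Set.pair_comm]; exact h.2⟩⟩
  loopless := ⟨fun _ h => h.1 rfl⟩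

/-- The subgraph of the generating graph induced by its non-isolated vertices
(`SimpleGraph.support` is the set of vertices that have a neighbour). -/
def nonIsolatedGeneratingGraph (G : Type*) [Group G] :
    SimpleGraph (generatingGraph G).support :=
  (generatingGraph G).induce (generatingGraph G).support

/-! Generation is tested one simple module at a time. A proper subgroup of a finite soluble group
lies in a maximal subgroup `M`. A minimal normal subgroup `A` not contained in `M` yields the simple
module `A/(A ∩ M)`, and `am ↦ a` is a derivation into it with kernel `M` that is nonzero on the
centralizer of the module (`exists_derivation_of_ne_top`). So two elements generate `G` as soon as,
for every finite simple `V`, each derivation into `V` killing both also kills `C = actionKer G V`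
(`Supplements`).

For a fixed `V` this is linear algebra over the division ring `End V`. An element `g` is seen
through its evaluation map `Der(G, V) → V`, and it suffices that consecutive evaluation maps along
`a₁, c₁, c₂, a₂` have kernels meeting in zero. Since `a₁, b₁` generate `G`, `Der(G, V)` has
dimension at most `2 dim V`, and the kernels of evaluation at `a₁` and `a₂` have dimension at most
`dim V`. The derivations vanishing on `C` form a subspace `Z₀`. It is zero if `G` acts trivially,
and otherwise consists of inner derivations (`exists_inner`), so its dimension is at most `dim V`.
Maps prescribed on `Z₀` then extend to all derivations with the required kernels
(`LinearMap.exists_path_extension`). The one exceptional configuration, `dim V = dim Z₀ = 1` over a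
field of two elements, would force a trivial action, hence `Z₀ = 0`.

The modules are treated in turn by descending through normal subgroups `S`
(`exists_path_above_bot`), starting from `S = G`. A module `V` with `S` not in its crown kernel is
taken with `actionKer G V` maximal, and `c₁, c₂` are multiplied by elements of `S` that realize the
extended maps (`exists_mem_forall_derivation_eq`). This changes nothing for modules whose crown
kernel contains `S`. Then `S` is replaced by its intersection with the crown kernel of `V`. -/

section LinearAlgebra

/-! ### Exchange arguments and common complements over a division ring. -/

open Module Submodule

variable {F Z : Type*} [DivisionRing F] [AddCommGroup Z] [Module F Z]

theorem Submodule.exists_notMem_notMem {A B : Submodule F Z} (hA : A ≠ ⊤) (hB : B ≠ ⊤) :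
    ∃ v, v ∉ A ∧ v ∉ B := by
  obtain ⟨a, ha⟩ : ∃ a, a ∉ A := by
    by_contra! h; exact hA (eq_top_iff.2 fun x _ => h x)
  obtain ⟨b, hb⟩ : ∃ b, b ∉ B := by
    by_contra! h; exact hB (eq_top_iff.2 fun x _ => h x)
  by_cases h1 : a ∈ B
  · by_cases h2 : b ∈ A
    · exact ⟨a + b, fun h => ha ((add_mem_cancel_right h2).1 h),
        fun h => hb ((add_mem_cancel_left h1).1 h)⟩
    · exact ⟨b, h2, hb⟩
  · exact ⟨a, ha, h1⟩

theorem Submodule.sup_span_singleton_inf_of_notMem {T A : Submodule F Z} {v : Z}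
    (hv : v ∉ T ⊔ A) : (T ⊔ span F {v}) ⊓ A = T ⊓ A := by
  refine le_antisymm ?_ (inf_le_inf_right _ le_sup_left)
  rintro x ⟨hx, hxA⟩
  obtain ⟨t, ht, w, hw, rfl⟩ := mem_sup.1 hx
  obtain ⟨c, rfl⟩ := mem_span_singleton.1 hw
  rcases eq_or_ne c 0 with rfl | hc
  · simpa using ⟨ht, by simpa using hxA⟩
  · refine absurd ?_ hv
    have h : v = c⁻¹ • (-t + (t + c • v)) := by simp [smul_smul, hc]
    rw [h]
    exact smul_mem _ _ (add_mem_sup (neg_mem ht) hxA)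

/-- A vector of `T` outside `N ≤ T` is avoided by a hyperplane of `T` containing `N`. -/
theorem Submodule.exists_hyperplane {T N : Submodule F Z} {u : Z} (hN : N ≤ T) (hu : u ∈ T)
    (huN : u ∉ N) : ∃ T', N ≤ T' ∧ T' ≤ T ∧ u ∉ T' ∧ T' ⊔ span F {u} = T := by
  have hd : Disjoint N (span F {u}) := by
    rw [disjoint_iff, inf_comm]
    simpa using sup_span_singleton_inf_of_notMem (T := ⊥) (A := N) (v := u) (by simpa using huN)
  obtain ⟨C, hC, hcompl⟩ := hd.exists_isCompl
  have hu0 : u ≠ 0 := by rintro rfl; exact huN (zero_mem _)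
  have huT : span F {u} ≤ T := by simpa using hu
  refine ⟨C ⊓ T, le_inf hC hN, inf_le_right, fun h => hu0 ?_, ?_⟩
  · have : u ∈ C ⊓ span F {u} := ⟨h.1, mem_span_singleton_self u⟩
    simpa [hcompl.inf_eq_bot] using this
  · rw [inf_comm, inf_sup_assoc_of_le _ huT, hcompl.sup_eq_top, inf_top_eq]

variable [FiniteDimensional F Z]

/-- A subspace can be enlarged to a given dimension without enlarging its intersections with two
subspaces of complementary dimension. -/
theorem Submodule.exists_ge_inf_eq_inf_eq {n : ℕ} (T A B : Submodule F Z) (hT : finrank F T ≤ n)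
    (hA : finrank F A + n ≤ finrank F Z) (hB : finrank F B + n ≤ finrank F Z) :
    ∃ T', T ≤ T' ∧ finrank F T' = n ∧ T' ⊓ A = T ⊓ A ∧ T' ⊓ B = T ⊓ B := by
  induction n, hT using Nat.le_induction with
  | base => exact ⟨T, le_rfl, rfl, rfl, rfl⟩
  | succ m hm ih =>
    obtain ⟨T', h1, h2, h3, h4⟩ := ih (by omega) (by omega)
    have key : ∀ A : Submodule F Z, finrank F A + (m + 1) ≤ finrank F Z → T' ⊔ A ≠ ⊤ := by
      intro A hA h
      have := finrank_sup_add_finrank_inf_eq T' A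
      rw [h, finrank_top] at this
      omega
    obtain ⟨v, hvA, hvB⟩ := exists_notMem_notMem (key A hA) (key B hB)
    exact ⟨T' ⊔ span F {v}, h1.trans le_sup_left,
      by rw [Submodule.finrank_sup_span_singleton fun h => hvA (mem_sup_left h), h2],
      by rw [sup_span_singleton_inf_of_notMem hvA, h3],
      by rw [sup_span_singleton_inf_of_notMem hvB, h4]⟩

/-- The witness is `T' ⊔ span F {v}`: the vector `u` of `T ⊓ U` is traded for `v`. As `v` avoids the
three sums, adding it to `T'` enlarges no intersection, while dropping `u` shrinks the one with `U`.
-/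
theorem Submodule.exchange {T K Z₀ U T' : Submodule F Z} {u v : Z} (hTK : T ⊓ K = ⊥)
    (hT' : T' ≤ T) (hN : T ⊓ Z₀ ≤ T') (huT : T' ⊔ span F {u} = T) (huT' : u ∉ T') (huU : u ∈ U)
    (hK : v ∉ T' ⊔ K) (hZ : v ∉ T' ⊔ Z₀) (hU : v ∉ T ⊔ U) :
    ∃ S : Submodule F Z, finrank F S = finrank F T ∧ S ⊓ Z₀ = T ⊓ Z₀ ∧ S ⊓ K = ⊥ ∧
      S ⊓ U < T ⊓ U := by
  refine ⟨T' ⊔ span F {v}, ?_, ?_, ?_, ?_⟩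
  · rw [Submodule.finrank_sup_span_singleton fun h => hK (mem_sup_left h), ← huT,
      Submodule.finrank_sup_span_singleton huT']
  · rw [sup_span_singleton_inf_of_notMem hZ]
    exact le_antisymm (inf_le_inf_right _ hT') (le_inf hN inf_le_right)
  · rw [sup_span_singleton_inf_of_notMem hK]
    exact eq_bot_iff.2 ((inf_le_inf_right _ hT').trans hTK.le)
  · rw [sup_span_singleton_inf_of_notMem fun h => hU (sup_le_sup_right hT' _ h)]
    refine lt_of_le_of_ne (inf_le_inf_right _ hT') fun h => huT' ?_
    have : u ∈ T ⊓ U := ⟨huT ▸ mem_sup_right (mem_span_singleton_self u), huU⟩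
    rw [← h] at this
    exact this.1

theorem Submodule.sup_eq_top_of_finrank {n : ℕ} {A B : Submodule F Z} (hZ : finrank F Z = 2 * n)
    (hA : finrank F A = n) (hB : finrank F B = n) (h : A ⊓ B = ⊥) : A ⊔ B = ⊤ := by
  apply eq_top_of_finrank_eq
  have := finrank_sup_add_finrank_inf_eq A B
  rw [h, finrank_bot] at this
  omega

theorem Submodule.sup_ne_top_of_finrank {n : ℕ} {A B : Submodule F Z} (hZ : finrank F Z = 2 * n)
    (hA : finrank F A ≤ n) (hB : finrank F B ≤ n) (h : A ⊓ B ≠ ⊥) : A ⊔ B ≠ ⊤ := by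
  intro h'
  have := finrank_sup_add_finrank_inf_eq A B
  rw [h', finrank_top] at this
  have : finrank F ↥(A ⊓ B) ≠ 0 := fun h0 => h (finrank_eq_zero.1 h0)
  omega

/-- Two proper subspaces `T ⊔ U` and `T ⊔ Z₀` can be avoided by one vector `t + k` with `t ∈ T`, `k
∈ K`. Modulo `T` the part `t` is irrelevant, so it may be replaced by `u`; since `u ∉ T'`, the
vector `u + k` also avoids `T' ⊔ K`. -/
theorem Submodule.exists_exchange_of_sup_ne_top {n : ℕ} {T K Z₀ U : Submodule F Z}
    (hZ : finrank F Z = 2 * n) (hT : finrank F T = n) (hK : finrank F K = n)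
    (hU : finrank F U = n) (hTK : T ⊓ K = ⊥) (hTU : T ⊓ U ≠ ⊥) (h0 : T ⊓ U ⊓ Z₀ = ⊥)
    (hTZ : T ⊔ Z₀ ≠ ⊤) :
    ∃ S : Submodule F Z, finrank F S = n ∧ S ⊓ Z₀ = T ⊓ Z₀ ∧ S ⊓ K = ⊥ ∧ S ⊓ U < T ⊓ U := by
  obtain ⟨u, hu, hu0⟩ := exists_mem_ne_zero_of_ne_bot hTU
  have huN : u ∉ T ⊓ Z₀ := fun h => hu0 ((mem_bot F).1 (h0 ▸ (⟨hu, h.2⟩ : u ∈ T ⊓ U ⊓ Z₀)))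
  obtain ⟨v, hvU, hvZ⟩ :=
    exists_notMem_notMem (sup_ne_top_of_finrank hZ hT.le hU.le hTU) hTZ
  obtain ⟨t, ht, k, hk, rfl⟩ :=
    mem_sup.1 ((sup_eq_top_of_finrank hZ hT hK hTK).ge (mem_top : v ∈ ⊤))
  obtain ⟨T', hNT', hT'T, huT', hsup⟩ := exists_hyperplane inf_le_left hu.1 huN
  have hmem : ∀ B : Submodule F Z, t + k ∉ T ⊔ B → u + k ∉ T ⊔ B := by
    intro B h h'
    refine h ?_
    have : t + k = (t - u) + (u + k) := by abel
    rw [this]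
    exact add_mem (mem_sup_left (sub_mem ht hu.1)) h'
  refine hT ▸ exchange hTK hT'T hNT' hsup huT' hu.2 (v := u + k) ?_
    (fun h => hmem _ hvZ (sup_le_sup_right hT'T _ h)) (hmem _ hvU)
  intro h
  have h1 : u ∈ T' ⊔ K := by simpa using sub_mem h (mem_sup_right hk)
  obtain ⟨t', ht', k', hk', rfl⟩ := mem_sup.1 h1
  have : k' ∈ T ⊓ K := ⟨by simpa using sub_mem hu.1 (hT'T ht'), hk'⟩
  rw [hTK, mem_bot] at this
  exact huT' (by simpa [this] using ht')

/-- Here `T ⊔ Z₀` is everything, so only `T' ⊔ Z₀` can be avoided and `T'` has to be chosen with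
care. The new vector is `μ • u + k` with `k ∈ K` outside `H`. Writing `k = -s + z` along `T ⊕ Z₀`,
the condition becomes `μ • u - s ∉ T'`. Only `s = u` over a field of two elements is an obstruction,
and a vector of `K ⊓ H` outside `Z₀` then moves `s`. -/
theorem Submodule.exists_exchange_of_isCompl {n : ℕ} {T K Z₀ U H : Submodule F Z}
    (hZ : finrank F Z = 2 * n) (hT : finrank F T = n) (hK : finrank F K = n)
    (hZ₀ : finrank F Z₀ = n) (hTK : T ⊓ K = ⊥) (hTU : T ⊓ U ≠ ⊥)
    (hTZ : T ⊓ Z₀ = ⊥) (hUH : T ⊔ U ≤ H) (hH : H ≠ ⊤)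
    (hF : (∃ μ : F, μ ≠ 0 ∧ μ ≠ 1) ∨ ¬ K ⊓ H ≤ Z₀) :
    ∃ S : Submodule F Z, finrank F S = n ∧ S ⊓ Z₀ = T ⊓ Z₀ ∧ S ⊓ K = ⊥ ∧ S ⊓ U < T ⊓ U := by
  obtain ⟨u, hu, hu0⟩ := exists_mem_ne_zero_of_ne_bot hTU
  have hTKtop := sup_eq_top_of_finrank hZ hT hK hTK
  have hTZtop := sup_eq_top_of_finrank hZ hT hZ₀ hTZ
  have hTH : T ≤ H := le_sup_left.trans hUH
  suffices h : ∃ (k z s : Z) (μ : F) (T' : Submodule F Z), k ∈ K ∧ z ∈ Z₀ ∧ k = -s + z ∧ k ∉ H ∧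
      T' ≤ T ∧ u ∉ T' ∧ T' ⊔ span F {u} = T ∧ μ ≠ 0 ∧ μ • u - s ∉ T' ∧ s ∈ T by
    obtain ⟨k, z, s, μ, T', hk, hz, hkz, hkU, hT'T, huT', hsup, hμ, hμs, hs⟩ := h
    refine hT ▸ exchange hTK hT'T (by simp [hTZ]) hsup huT' hu.2 (v := μ • u + k) ?_ ?_ ?_
    · intro h
      have h1 : μ • u ∈ T' ⊔ K := by simpa using sub_mem h (mem_sup_right hk)
      obtain ⟨t', ht', k', hk', h2⟩ := mem_sup.1 h1
      have : k' ∈ T ⊓ K := ⟨by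
        rw [← add_sub_cancel_left t' k', h2]; exact sub_mem (smul_mem _ _ hu.1) (hT'T ht'), hk'⟩
      rw [hTK, mem_bot] at this
      rw [this, add_zero] at h2
      exact huT' ((smul_mem_iff _ hμ).1 (h2 ▸ ht'))
    · intro h
      have h1 : μ • u - s ∈ T' ⊔ Z₀ := by
        have : μ • u - s = (μ • u + k) - z := by rw [hkz]; abel
        rw [this]; exact sub_mem h (mem_sup_right hz)
      obtain ⟨t', ht', k', hk', h2⟩ := mem_sup.1 h1
      have : k' ∈ T ⊓ Z₀ := ⟨by
        rw [← add_sub_cancel_left t' k', h2]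
        exact sub_mem (sub_mem (smul_mem _ _ hu.1) hs) (hT'T ht'), hk'⟩
      rw [hTZ, mem_bot] at this
      rw [this, add_zero] at h2
      exact hμs (h2 ▸ ht')
    · intro h
      refine hkU ?_
      simpa using sub_mem (hUH h) (hTH (smul_mem _ μ hu.1))
  have decomp : ∀ v, v ∉ H → ∃ t ∈ T, ∃ k ∈ K, ∃ t' ∈ T, ∃ z ∈ Z₀, v = t + k ∧ v = t' + z ∧
      k ∉ H := by
    intro v hv
    obtain ⟨t, ht, k, hk, h1⟩ := mem_sup.1 (hTKtop.ge (mem_top : v ∈ ⊤))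
    obtain ⟨t', ht', z, hz, h2⟩ := mem_sup.1 (hTZtop.ge (mem_top : v ∈ ⊤))
    exact ⟨t, ht, k, hk, t', ht', z, hz, h1.symm, h2.symm,
      fun h => hv (h1 ▸ add_mem (hTH ht) h)⟩
  obtain ⟨v, hv⟩ : ∃ v, v ∉ H := by
    by_contra! h; exact hH (eq_top_iff.2 fun x _ => h x)
  -- everything follows once `s ≠ u`, or the field has an element different from `0` and `1`
  have main : ∀ k ∈ K, ∀ z ∈ Z₀, ∀ s ∈ T, k = -s + z → k ∉ H →
      (s ≠ u ∨ ∃ μ : F, μ ≠ 0 ∧ μ ≠ 1) →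
      ∃ (k z s : Z) (μ : F) (T' : Submodule F Z), k ∈ K ∧ z ∈ Z₀ ∧ k = -s + z ∧ k ∉ H ∧
      T' ≤ T ∧ u ∉ T' ∧ T' ⊔ span F {u} = T ∧ μ ≠ 0 ∧ μ • u - s ∉ T' ∧ s ∈ T := by
    intro k hk z hz s hs hkz hkU hor
    -- If `s = c • u`, any hyperplane `T'` of `T` missing `u` works with `μ ≠ 0, c`. Otherwise `T'`
    -- is chosen to contain `s` but not `u`, and `μ = 1` works.
    by_cases hsu : s ∈ span F {u}
    · obtain ⟨c, rfl⟩ := mem_span_singleton.1 hsu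
      obtain ⟨μ, hμ0, hμc⟩ : ∃ μ : F, μ ≠ 0 ∧ μ ≠ c := by
        by_cases hc : c = 1
        · subst hc
          exact hor.resolve_left (by simp)
        · exact ⟨1, one_ne_zero, Ne.symm hc⟩
      obtain ⟨T', -, hT'T, huT', hsup⟩ := exists_hyperplane (N := ⊥) bot_le hu.1 (by simpa using hu0)
      refine ⟨k, z, _, μ, T', hk, hz, hkz, hkU, hT'T, huT', hsup, hμ0, ?_, hs⟩
      rw [← sub_smul, smul_mem_iff _ (sub_ne_zero.2 hμc)]
      exact huT'
    · have hus : u ∉ span F {s} := by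
        intro h
        obtain ⟨c, rfl⟩ := mem_span_singleton.1 h
        have hc : c ≠ 0 := by rintro rfl; simp at hu0
        exact hsu (mem_span_singleton.2 ⟨c⁻¹, by simp [smul_smul, hc]⟩)
      obtain ⟨T', hsT', hT'T, huT', hsup⟩ := exists_hyperplane (by simpa using hs) hu.1 hus
      refine ⟨k, z, s, 1, T', hk, hz, hkz, hkU, hT'T, huT', hsup, one_ne_zero, ?_, hs⟩
      rw [one_smul]
      intro h
      exact huT' (by simpa using add_mem h (hsT' (mem_span_singleton_self s)))
  obtain ⟨t, ht, k, hk, t', ht', z, hz, h1, h2, hkU⟩ := decomp v hv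
  have hk1 : k = -(t - t') + z := by
    have : k = v - t := by rw [h1]; abel
    rw [this, h2]; abel
  by_cases hsu : t - t' = u
  · rcases hF with hF | hF
    · exact main k hk z hz (t - t') (sub_mem ht ht') hk1 hkU (Or.inr hF)
    · obtain ⟨y, ⟨hyK, hyU⟩, hyZ⟩ := SetLike.not_le_iff_exists.1 hF
      obtain ⟨y', hy', w, hw, hy⟩ := mem_sup.1 (hTZtop.ge (mem_top : y ∈ ⊤))
      have hy0 : y' ≠ 0 := by rintro rfl; exact hyZ (by simpa [← hy] using hw)
      refine main (k + y) (add_mem hk hyK) (z + w) (add_mem hz hw) (t - t' - y')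
        (sub_mem (sub_mem ht ht') hy') (by rw [hk1, ← hy]; abel)
        (fun h => hkU ((add_mem_cancel_right hyU).1 h)) (Or.inl ?_)
      rw [hsu]
      simpa using hy0
  · exact main k hk z hz (t - t') (sub_mem ht ht') hk1 hkU (Or.inl hsu)

/-- If `K ≰ Z₀`, then `K` is `K ⊓ Z₀` plus one vector `t + z` with `t ∈ U`, `z ∈ Z₀`. A complement
`S` of `Z₀` and `U` is built through `t + w`, where `w ∈ Z₀` is nonzero and `w - z ∉ K`. Subtracting
a multiple of `t + w` from a vector of `S ⊓ K` lands in `S ⊓ Z₀ = ⊥`, which forces the vector to be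
zero. -/
theorem Submodule.exists_common_compl_of_finrank_inf {n : ℕ} {K Z₀ U : Submodule F Z}
    (hn : 2 ≤ n) (hZ : finrank F Z = 2 * n) (hK : finrank F K = n) (hZ₀ : finrank F Z₀ = n)
    (hU : finrank F U = n) (hUZ : U ⊓ Z₀ = ⊥) (hKZ : n ≤ finrank F ↥(K ⊓ Z₀) + 1) :
    ∃ S : Submodule F Z, finrank F S = n ∧ S ⊓ Z₀ = ⊥ ∧ S ⊓ K = ⊥ ∧ S ⊓ U = ⊥ := by
  have hd1 : finrank F Z₀ + n ≤ finrank F Z := by omega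
  have hd2 : finrank F U + n ≤ finrank F Z := by omega
  by_cases hle : K ≤ Z₀
  · obtain rfl : K = Z₀ := eq_of_le_of_finrank_eq hle (by omega)
    obtain ⟨S, -, h1, h2, h3⟩ := exists_ge_inf_eq_inf_eq (n := n) ⊥ K U (by simp) hd1 hd2
    exact ⟨S, h1, by simpa using h2, by simpa using h2, by simpa using h3⟩
  obtain ⟨k, hkK, hkZ⟩ := SetLike.not_le_iff_exists.1 hle
  have hKsup : (K ⊓ Z₀) ⊔ span F {k} = K := by
    refine eq_of_le_of_finrank_le (sup_le inf_le_left (by simpa using hkK)) ?_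
    rw [Submodule.finrank_sup_span_singleton fun h => hkZ (mem_inf.1 h).2]
    omega
  obtain ⟨t, ht, z, hz, rfl⟩ :=
    mem_sup.1 ((sup_eq_top_of_finrank hZ hU hZ₀ hUZ).ge (mem_top : k ∈ ⊤))
  have ht0 : t ≠ 0 := by rintro rfl; exact hkZ (by simpa using hz)
  obtain ⟨w, hw, hw0, hwz⟩ : ∃ w ∈ Z₀, w ≠ 0 ∧ w - z ∉ K := by
    by_cases hzK : z ∈ K
    · have : ¬ Z₀ ≤ K := fun h => hle (eq_of_le_of_finrank_eq h (by omega)).ge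
      obtain ⟨w, hw, hwK⟩ := SetLike.not_le_iff_exists.1 this
      exact ⟨w, hw, by rintro rfl; exact hwK (zero_mem _),
        fun h => hwK (by simpa using add_mem h hzK)⟩
    · have : K ⊓ Z₀ ≠ ⊥ := by
        intro h
        rw [h, finrank_bot] at hKZ
        omega
      obtain ⟨w, hw, hw0⟩ := exists_mem_ne_zero_of_ne_bot this
      exact ⟨w, hw.2, hw0, fun h => hzK (by simpa using sub_mem hw.1 h)⟩
  have hbot : ∀ A : Submodule F Z, t + w ∉ A → span F {t + w} ⊓ A = ⊥ := by
    intro A hA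
    simpa using sup_span_singleton_inf_of_notMem (T := ⊥) (A := A) (v := t + w) (by simpa using hA)
  have hZbot := hbot Z₀ fun h => ht0 ((mem_bot F).1 (hUZ ▸ (⟨ht, by simpa using sub_mem h hw⟩ : t ∈ U ⊓ Z₀)))
  have hUbot := hbot U fun h => hw0 ((mem_bot F).1 (hUZ ▸ (⟨by simpa using sub_mem h ht, hw⟩ : w ∈ U ⊓ Z₀)))
  obtain ⟨S, hS, hSn, hSZ, hSU⟩ := exists_ge_inf_eq_inf_eq (n := n) (span F {t + w}) Z₀ U
    ((finrank_span_le_card _).trans (by simp; omega)) hd1 hd2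
  rw [hZbot] at hSZ
  refine ⟨S, hSn, hSZ, ?_, hSU.trans hUbot⟩
  rw [eq_bot_iff]
  rintro x ⟨hxS, hxK⟩
  rw [SetLike.mem_coe, ← hKsup] at hxK
  obtain ⟨d, ⟨hdK, hdZ⟩, y, hy, rfl⟩ := mem_sup.1 hxK
  obtain ⟨c, rfl⟩ := mem_span_singleton.1 hy
  have h1 : d + c • (z - w) ∈ S ⊓ Z₀ := by
    refine ⟨?_, add_mem hdZ (smul_mem _ _ (sub_mem hz hw))⟩
    have : d + c • (z - w) = d + c • (t + z) - c • (t + w) := by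
      simp only [smul_sub, smul_add]; abel
    rw [this]
    exact sub_mem hxS (smul_mem _ _ (hS (mem_span_singleton_self _)))
  rw [hSZ, mem_bot] at h1
  rcases eq_or_ne c 0 with rfl | hc
  · simp at h1
    simp [h1]
  · refine absurd ?_ hwz
    rw [← smul_mem_iff K hc]
    have : c • (w - z) = d := by
      rw [eq_comm, eq_neg_of_add_eq_zero_left h1, ← smul_neg, neg_sub]
    rw [this]
    exact hdK

/-- Given subspaces `K₁, K₂` of dimension `n` and `Z₀` of dimension at most `n` in a space of
dimension `2 * n`, there are two complementary subspaces of dimension `n`, each complementary to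
`Kᵢ`, with prescribed intersections with `Z₀`. -/
theorem Submodule.exists_compl_pair {n : ℕ} {Z₀ K₁ K₂ N₁ N₂ : Submodule F Z}
    (hZ : finrank F Z = 2 * n) (hZ₀ : finrank F Z₀ ≤ n) (hK₁ : finrank F K₁ = n)
    (hK₂ : finrank F K₂ = n) (hN₁ : N₁ ≤ Z₀) (hN₂ : N₂ ≤ Z₀) (h₁ : N₁ ⊓ K₁ = ⊥)
    (h₂ : N₂ ⊓ K₂ = ⊥) (h₁₂ : N₁ ⊓ N₂ = ⊥)
    (hn : finrank F Z₀ < n ∨ 2 ≤ n ∨ ∃ μ : F, μ ≠ 0 ∧ μ ≠ 1) :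
    ∃ T₁ T₂ : Submodule F Z, finrank F T₁ = n ∧ finrank F T₂ = n ∧ T₁ ⊓ Z₀ = N₁ ∧ T₂ ⊓ Z₀ = N₂ ∧
      T₁ ⊓ K₁ = ⊥ ∧ T₂ ⊓ K₂ = ⊥ ∧ T₁ ⊓ T₂ = ⊥ := by
  have start : ∀ K N : Submodule F Z, finrank F K = n → N ≤ Z₀ → N ⊓ K = ⊥ →
      ∃ T : Submodule F Z, finrank F T = n ∧ T ⊓ Z₀ = N ∧ T ⊓ K = ⊥ := by
    intro K N hK hN h
    obtain ⟨T, -, h1, h2, h3⟩ := exists_ge_inf_eq_inf_eq (n := n) N Z₀ K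
      ((finrank_mono hN).trans hZ₀) (by omega) (by omega)
    exact ⟨T, h1, by rw [h2, inf_eq_left.2 hN], h3.trans h⟩
  obtain ⟨T₁, hT₁, hT₁Z, hT₁K⟩ := start K₁ N₁ hK₁ hN₁ h₁
  obtain ⟨T₂, hT₂, hT₂Z, hT₂K⟩ := start K₂ N₂ hK₂ hN₂ h₂
  induction hd : finrank F ↥(T₁ ⊓ T₂) using Nat.strong_induction_on generalizing T₁ T₂ with
  | _ d ih =>
    by_cases hbot : T₁ ⊓ T₂ = ⊥
    · exact ⟨T₁, T₂, hT₁, hT₂, hT₁Z, hT₂Z, hT₁K, hT₂K, hbot⟩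
    have h0 : T₁ ⊓ T₂ ⊓ Z₀ = ⊥ := by
      rw [← h₁₂, ← hT₁Z, ← hT₂Z, inf_inf_inf_comm, inf_idem]
    -- exchanging in either subspace is enough
    have step₁ : (∃ S : Submodule F Z, finrank F S = n ∧ S ⊓ Z₀ = T₁ ⊓ Z₀ ∧ S ⊓ K₁ = ⊥ ∧
        S ⊓ T₂ < T₁ ⊓ T₂) → _ := fun ⟨S, hS, hSZ, hSK, hlt⟩ =>
      ih _ (hd ▸ finrank_lt_finrank_of_lt hlt) S hS (hSZ.trans hT₁Z) hSK T₂ hT₂ hT₂Z hT₂K rfl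
    have step₂ : (∃ S : Submodule F Z, finrank F S = n ∧ S ⊓ Z₀ = T₂ ⊓ Z₀ ∧ S ⊓ K₂ = ⊥ ∧
        S ⊓ T₁ < T₂ ⊓ T₁) → _ := fun ⟨S, hS, hSZ, hSK, hlt⟩ =>
      have hlt' : finrank F ↥(T₁ ⊓ S) < d := by
        rw [← hd, inf_comm T₁ S, inf_comm T₁ T₂]; exact finrank_lt_finrank_of_lt hlt
      ih _ hlt' T₁ hT₁ hT₁Z hT₁K S hS (hSZ.trans hT₂Z) hSK rfl
    by_cases hs₁ : T₁ ⊔ Z₀ = ⊤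
    swap
    · exact step₁ (exists_exchange_of_sup_ne_top hZ hT₁ hK₁ hT₂ hT₁K hbot h0 hs₁)
    by_cases hs₂ : T₂ ⊔ Z₀ = ⊤
    swap
    · exact step₂ (exists_exchange_of_sup_ne_top hZ hT₂ hK₂ hT₁ hT₂K (by rwa [inf_comm])
        (by rwa [inf_comm T₂ T₁]) hs₂)
    have hb₁ : T₁ ⊓ Z₀ = ⊥ := by
      by_contra h; exact sup_ne_top_of_finrank hZ hT₁.le hZ₀ h hs₁
    have hb₂ : T₂ ⊓ Z₀ = ⊥ := by
      by_contra h; exact sup_ne_top_of_finrank hZ hT₂.le hZ₀ h hs₂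
    have hZ₀' : finrank F Z₀ = n := by
      have := finrank_sup_add_finrank_inf_eq T₁ Z₀
      rw [hs₁, finrank_top] at this
      omega
    obtain ⟨H, hH, hle⟩ := (eq_top_or_exists_le_coatom (T₁ ⊔ T₂)).resolve_left
      (sup_ne_top_of_finrank hZ hT₁.le hT₂.le hbot)
    by_cases hF : (∃ μ : F, μ ≠ 0 ∧ μ ≠ 1) ∨ ¬ K₁ ⊓ H ≤ Z₀
    · exact step₁ (exists_exchange_of_isCompl hZ hT₁ hK₁ hZ₀' hT₁K hbot hb₁ hle hH.1 hF)
    -- What is left: `0` and `1` are the only scalars and `K₁ ⊓ H ≤ Z₀`. Since `H` is a hyperplane,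
    -- `K₁ ⊓ Z₀` has codimension at most one in `K₁`, and `T₁` is replaced outright by a common
    -- complement of `Z₀`, `K₁` and `T₂`. This is legitimate because `N₁ = ⊥` here.
    push Not at hF
    have hdim : n ≤ finrank F ↥(K₁ ⊓ Z₀) + 1 := by
      obtain ⟨v, hv⟩ : ∃ v, v ∉ H := by
        by_contra! h; exact hH.1 (eq_top_iff.2 fun x _ => h x)
      have h1 := finrank_sup_span_singleton hv
      rw [hH.2 _ (left_lt_sup.2 (by simpa using hv)), finrank_top] at h1
      have h2 := finrank_sup_add_finrank_inf_eq K₁ H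
      have h3 := finrank_le (K₁ ⊔ H)
      have h4 := finrank_mono (le_inf inf_le_left hF.2 : K₁ ⊓ H ≤ K₁ ⊓ Z₀)
      omega
    obtain ⟨S, h1, h2, h3, h4⟩ := exists_common_compl_of_finrank_inf (by
      rcases hn with h | h | ⟨μ, h, h'⟩
      · omega
      · exact h
      · exact absurd (hF.1 μ h) h') hZ hK₁ hZ₀' hT₂ hb₂ hdim
    exact ⟨S, T₂, h1, hT₂, by rw [h2, ← hT₁Z, hb₁], hT₂Z, h3, hT₂K, h4⟩

/-! ### Linear maps with prescribed restriction and kernel. -/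

variable {V : Type*} [AddCommGroup V] [Module F V]

/-- A linear map can be altered off `Z₀` so that its kernel is `T`, provided that the intersection
of `T` with `Z₀` is the right one and that the codimension of `T` is small enough. -/
theorem LinearMap.exists_eqOn_ker_eq (c : Z →ₗ[F] V) {Z₀ T : Submodule F Z}
    (hT : finrank F Z ≤ finrank F T + finrank F V) (h : T ⊓ Z₀ = ker c ⊓ Z₀) :
    ∃ g : Z →ₗ[F] V, (∀ z ∈ Z₀, g z = c z) ∧ ker g = T := by
  have hagree : ∀ (x : Z₀) (y : T), (x : Z) = y → (c ∘ₗ Z₀.subtype) x = (0 : T →ₗ[F] V) y := by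
    rintro ⟨x, hx⟩ ⟨y, hy⟩ (rfl : x = y)
    have : x ∈ ker c ⊓ Z₀ := h ▸ ⟨hy, hx⟩
    simpa using this.1
  let p : Z →ₗ.[F] V := ⟨Z₀, c ∘ₗ Z₀.subtype⟩
  let q : Z →ₗ.[F] V := ⟨T, 0⟩
  -- The map equal to `c` on `Z₀` and to `0` on `T` is extended arbitrarily; its kernel may be too
  -- large. The induction below shrinks it by adding `f.smulRight y`, with `f` zero on `T ⊔ Z₀` but
  -- not at a superfluous kernel vector, and `y` outside the range.
  obtain ⟨g, hg⟩ := (p.sup q hagree).toFun.exists_extend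
  have hg' : ∀ (x : Z₀) (y : T), g (x + y) = c x := by
    intro x y
    have h1 := LinearPMap.sup_apply (f := p) (g := q) hagree x y
      (⟨(x : Z) + y, add_mem (mem_sup_left x.2) (mem_sup_right y.2)⟩ : ↥(p.sup q hagree).domain) rfl
    have h2 := congr($hg ⟨(x : Z) + y, add_mem (mem_sup_left x.2) (mem_sup_right y.2)⟩)
    refine (h2.trans h1).trans ?_
    simp [p, q]
  obtain ⟨h1, h2⟩ : (∀ z ∈ Z₀, g z = c z) ∧ T ≤ ker g := by
    refine ⟨fun z hz => by simpa using hg' ⟨z, hz⟩ 0, fun t ht => ?_⟩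
    simpa using hg' 0 ⟨t, ht⟩
  clear hg hg'
  induction hd : finrank F (ker g) using Nat.strong_induction_on generalizing g with
  | _ d ih =>
    by_cases hle : ker g ≤ T
    · exact ⟨g, h1, le_antisymm hle h2⟩
    obtain ⟨x, hx, hxT⟩ := SetLike.not_le_iff_exists.1 hle
    have hxW : x ∉ T ⊔ Z₀ := by
      intro hxW
      obtain ⟨t, ht, z, hz, rfl⟩ := mem_sup.1 hxW
      have hgz : g z = 0 := by
        have := mem_ker.1 hx
        rwa [map_add, mem_ker.1 (h2 ht), zero_add] at this
      have : z ∈ T ⊓ Z₀ := h ▸ ⟨mem_ker.2 (by rw [← h1 z hz, hgz]), hz⟩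
      exact hxT (add_mem ht this.1)
    obtain ⟨f, hfx, hf⟩ := exists_le_ker_of_notMem hxW
    have hlt := finrank_lt_finrank_of_lt (lt_of_le_of_ne h2 fun e => hle e.ge)
    obtain ⟨y, hy⟩ : ∃ y, y ∉ range g := by
      by_contra! hy
      have h3 := g.finrank_range_add_finrank_ker
      rw [(eq_top_iff.2 fun v _ => hy v : range g = ⊤), finrank_top] at h3
      omega
    let g' : Z →ₗ[F] V := g + f.smulRight y
    have hg' : ∀ z, g' z = g z + f z • y := fun z => rfl
    have hker : ker g' < ker g := by
      refine lt_of_le_of_ne (fun z hz => ?_) fun e => ?_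
      · rw [mem_ker, hg'] at hz
        rcases eq_or_ne (f z) 0 with h0 | h0
        · simpa [h0] using hz
        · refine absurd ⟨-(f z)⁻¹ • z, ?_⟩ hy
          rw [map_smul, eq_neg_of_add_eq_zero_left hz]
          simp [smul_smul, h0]
      · have : g' x = 0 := by
          rw [← mem_ker, e]; exact hx
        rw [hg', mem_ker.1 hx, zero_add, smul_eq_zero] at this
        exact this.elim hfx fun h0 => hy (h0 ▸ zero_mem _)
    refine ih _ (hd ▸ finrank_lt_finrank_of_lt hker) g' (fun z hz => ?_) (fun t ht => ?_) rfl
    · rw [hg', mem_ker.1 (hf (mem_sup_right hz)), zero_smul, add_zero, h1 z hz]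
    · rw [mem_ker, hg', mem_ker.1 (hf (mem_sup_left ht)), zero_smul, add_zero,
        mem_ker.1 (h2 ht)]

/-- Reduction of the inequalities to equalities: `Z` is padded to dimension `2 * n`, the `Kᵢ` are
enlarged to dimension `n` without meeting `Nᵢ`, and the resulting pair is pulled back. Pulling back
does not increase codimension. -/
theorem Submodule.exists_disjoint_pair {n : ℕ} {Z₀ K₁ K₂ N₁ N₂ : Submodule F Z}
    (hZ : finrank F Z ≤ 2 * n) (hZ₀ : finrank F Z₀ ≤ n) (hK₁ : finrank F K₁ ≤ n)
    (hK₂ : finrank F K₂ ≤ n) (hN₁ : N₁ ≤ Z₀) (hN₂ : N₂ ≤ Z₀) (h₁ : N₁ ⊓ K₁ = ⊥)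
    (h₂ : N₂ ⊓ K₂ = ⊥) (h₁₂ : N₁ ⊓ N₂ = ⊥)
    (hn : finrank F Z₀ < n ∨ 2 ≤ n ∨ ∃ μ : F, μ ≠ 0 ∧ μ ≠ 1) :
    ∃ T₁ T₂ : Submodule F Z, finrank F Z ≤ finrank F T₁ + n ∧ finrank F Z ≤ finrank F T₂ + n ∧
      T₁ ⊓ Z₀ = N₁ ∧ T₂ ⊓ Z₀ = N₂ ∧ T₁ ⊓ K₁ = ⊥ ∧ T₂ ⊓ K₂ = ⊥ ∧ T₁ ⊓ T₂ = ⊥ := by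
  let i : Z →ₗ[F] Z × (Fin (2 * n - finrank F Z) → F) := LinearMap.inl F _ _
  have hi : Function.Injective i := LinearMap.inl_injective
  have hker : LinearMap.ker i = ⊥ := LinearMap.ker_eq_bot.2 hi
  have hZ' : finrank F (Z × (Fin (2 * n - finrank F Z) → F)) = 2 * n := by
    rw [finrank_prod, finrank_fin_fun]; omega
  have hmap : ∀ A : Submodule F Z, finrank F ↥(A.map i) = finrank F A := fun A =>
    (A.equivMapOfInjective i hi).finrank_eq.symm
  have hbot : ∀ {A B : Submodule F Z}, A ⊓ B = ⊥ → A.map i ⊓ B.map i = ⊥ := by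
    intro A B h
    rw [← map_inf i hi, h, Submodule.map_bot]
  have enlarge : ∀ {K N : Submodule F Z}, finrank F K ≤ n → N ≤ Z₀ → N ⊓ K = ⊥ →
      ∃ K', K.map i ≤ K' ∧ finrank F K' = n ∧ N.map i ⊓ K' = ⊥ := by
    intro K N hK hN h
    have h1 : finrank F ↥(N.map i) + n ≤ finrank F (Z × (Fin (2 * n - finrank F Z) → F)) := by
      have := finrank_mono hN
      rw [hmap, hZ']; omega
    obtain ⟨K', h2, h3, h4, -⟩ :=
      exists_ge_inf_eq_inf_eq (n := n) (K.map i) (N.map i) (N.map i) (by rwa [hmap]) h1 h1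
    exact ⟨K', h2, h3, by rw [inf_comm, h4, inf_comm, hbot h]⟩
  obtain ⟨K₁', hK₁', hK₁n, hNK₁⟩ := enlarge hK₁ hN₁ h₁
  obtain ⟨K₂', hK₂', hK₂n, hNK₂⟩ := enlarge hK₂ hN₂ h₂
  obtain ⟨T₁, T₂, h1, h2, h3, h4, h5, h6, h7⟩ := exists_compl_pair (Z₀ := Z₀.map i) hZ'
    (by rwa [hmap]) hK₁n hK₂n (map_mono hN₁) (map_mono hN₂) hNK₁ hNK₂ (hbot h₁₂) (by rwa [hmap])
  have codim : ∀ {T : Submodule F (Z × (Fin (2 * n - finrank F Z) → F))}, finrank F T = n →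
      finrank F Z ≤ finrank F ↥(T.comap i) + n := by
    intro T hT
    have e1 := (T.mkQ ∘ₗ i).finrank_range_add_finrank_ker
    rw [LinearMap.ker_comp, ker_mkQ] at e1
    have e2 := finrank_le (LinearMap.range (T.mkQ ∘ₗ i))
    have e3 := T.finrank_quotient_add_finrank
    omega
  have trace : ∀ {T N}, T ⊓ Z₀.map i = N.map i → T.comap i ⊓ Z₀ = N := by
    intro T N h
    have := congr(Submodule.comap i $h)
    rwa [comap_inf, comap_map_eq_of_injective hi, comap_map_eq_of_injective hi] at this
  have disj : ∀ {T K'} {K : Submodule F Z}, T ⊓ K' = ⊥ → K.map i ≤ K' → T.comap i ⊓ K = ⊥ := by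
    intro T K' K h hK
    rw [eq_bot_iff, ← hker, ← Submodule.comap_bot, ← h, comap_inf]
    exact inf_le_inf_left _ (map_le_iff_le_comap.1 hK)
  exact ⟨T₁.comap i, T₂.comap i, codim h1, codim h2, trace h3, trace h4, disj h5 hK₁', disj h6 hK₂',
    disj h7 (map_comap_le _ _)⟩

/-- Two linear maps that are prescribed on `Z₀` can be extended so that the consecutive terms of
`a₁, g₁, g₂, a₂` have kernels with trivial intersection, if this holds on `Z₀`. -/
theorem LinearMap.exists_path_extension {Z₀ : Submodule F Z} (a₁ a₂ c₁ c₂ : Z →ₗ[F] V)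
    (hZ : finrank F Z ≤ 2 * finrank F V) (hZ₀ : finrank F Z₀ ≤ finrank F V)
    (ha₁ : finrank F (ker a₁) ≤ finrank F V) (ha₂ : finrank F (ker a₂) ≤ finrank F V)
    (h₁ : ∀ z ∈ Z₀, a₁ z = 0 → c₁ z = 0 → z = 0) (h₁₂ : ∀ z ∈ Z₀, c₁ z = 0 → c₂ z = 0 → z = 0)
    (h₂ : ∀ z ∈ Z₀, c₂ z = 0 → a₂ z = 0 → z = 0)
    (hn : finrank F Z₀ < finrank F V ∨ 2 ≤ finrank F V ∨ ∃ μ : F, μ ≠ 0 ∧ μ ≠ 1) :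
    ∃ g₁ g₂ : Z →ₗ[F] V, (∀ z ∈ Z₀, g₁ z = c₁ z) ∧ (∀ z ∈ Z₀, g₂ z = c₂ z) ∧
      (∀ z, a₁ z = 0 → g₁ z = 0 → z = 0) ∧ (∀ z, g₁ z = 0 → g₂ z = 0 → z = 0) ∧
      (∀ z, g₂ z = 0 → a₂ z = 0 → z = 0) := by
  obtain ⟨T₁, T₂, hT₁, hT₂, hTZ₁, hTZ₂, hTK₁, hTK₂, hT⟩ := exists_disjoint_pair
    (Z₀ := Z₀) (K₁ := ker a₁) (K₂ := ker a₂) (N₁ := ker c₁ ⊓ Z₀) (N₂ := ker c₂ ⊓ Z₀) hZ hZ₀ ha₁ ha₂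
    inf_le_right inf_le_right
    (eq_bot_iff.2 fun z hz => h₁ z hz.1.2 hz.2 hz.1.1)
    (eq_bot_iff.2 fun z hz => h₂ z hz.1.2 hz.1.1 hz.2)
    (eq_bot_iff.2 fun z hz => h₁₂ z hz.1.2 hz.1.1 hz.2.1) hn
  obtain ⟨g₁, hg₁, rfl⟩ := exists_eqOn_ker_eq c₁ hT₁ hTZ₁
  obtain ⟨g₂, hg₂, rfl⟩ := exists_eqOn_ker_eq c₂ hT₂ hTZ₂
  exact ⟨g₁, g₂, hg₁, hg₂, fun z h h' => (mem_bot F).1 (hTK₁ ▸ ⟨h', h⟩),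
    fun z h h' => (mem_bot F).1 (hT ▸ ⟨h, h'⟩), fun z h h' => (mem_bot F).1 (hTK₂ ▸ ⟨h, h'⟩)⟩

end LinearAlgebra

/-! ### Modules over the group ring, derivations and crown kernels. -/

open MonoidAlgebra in
/-- An additive subgroup that is stable under a group is a submodule over the group ring. -/
def AddSubgroup.toGroupRingSubmodule {G V : Type*} [Group G] [AddCommGroup V]
    [Module (MonoidAlgebra ℤ G) V] (W : AddSubgroup V)
    (hW : ∀ g : G, ∀ w ∈ W, of ℤ G g • w ∈ W) : Submodule (MonoidAlgebra ℤ G) V where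
  __ := W
  smul_mem' r w hw := by
    induction r using MonoidAlgebra.induction_on with
    | of g => exact hW g w hw
    | add x y hx hy => rw [add_smul]; exact W.add_mem hx hy
    | smul n x hx => rw [smul_assoc]; exact W.zsmul_mem hx n

namespace GroupRingModule

open MonoidAlgebra Module

variable {G : Type*} [Group G] {V : Type*} [AddCommGroup V] [Module (MonoidAlgebra ℤ G) V]

theorem of_mul_smul (g h : G) (v : V) : of ℤ G (g * h) • v = of ℤ G g • of ℤ G h • v := by
  rw [map_mul, mul_smul]

theorem of_one_smul (v : V) : of ℤ G 1 • v = v := by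
  rw [map_one, one_smul]

theorem of_inv_smul_smul (g : G) (v : V) : of ℤ G g⁻¹ • of ℤ G g • v = v := by
  rw [← of_mul_smul, inv_mul_cancel, of_one_smul]

theorem of_smul_inv_smul (g : G) (v : V) : of ℤ G g • of ℤ G g⁻¹ • v = v := by
  rw [← of_mul_smul, mul_inv_cancel, of_one_smul]

theorem of_smul_eq_zero {g : G} {v : V} (h : of ℤ G g • v = 0) : v = 0 := by
  rw [← of_inv_smul_smul g v, h, smul_zero]

variable (G V) in
/-- The kernel of the action of a group on a module over its group ring. -/
def actionKer : Subgroup G where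
  carrier := {g | ∀ v : V, of ℤ G g • v = v}
  one_mem' v := of_one_smul v
  mul_mem' {g h} hg hh v := by rw [of_mul_smul, hh, hg]
  inv_mem' {g} hg v := by conv_lhs => rw [← hg v, of_inv_smul_smul]

instance : (actionKer G V).Normal where
  conj_mem n hn g v := by rw [of_mul_smul, of_mul_smul, hn, of_smul_inv_smul]

variable (V) in
/-- The vectors fixed by a normal subgroup. -/
def fixedSubmodule (A : Subgroup G) [A.Normal] : Submodule (MonoidAlgebra ℤ G) V :=
  AddSubgroup.toGroupRingSubmodule
    { carrier := {v | ∀ a ∈ A, of ℤ G a • v = v}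
      zero_mem' := fun _ _ => smul_zero _
      add_mem' := fun hv hw a ha => by rw [smul_add, hv a ha, hw a ha]
      neg_mem' := fun hv a ha => by rw [smul_neg, hv a ha] }
    (fun g v hv a ha => by
      have h : a * g = g * (g⁻¹ * a * g⁻¹⁻¹) := by group
      rw [← of_mul_smul, h, of_mul_smul, hv _ (Subgroup.Normal.conj_mem ‹_› a ha g⁻¹)])

/-- By normality the vectors fixed by `A` form a submodule, which is nonzero and hence everything.
-/
theorem le_actionKer_of_fixed [IsSimpleModule (MonoidAlgebra ℤ G) V] {A : Subgroup G} [A.Normal]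
    {v : V} (hv0 : v ≠ 0) (hv : ∀ a ∈ A, of ℤ G a • v = v) : A ≤ actionKer G V := by
  rcases eq_bot_or_eq_top (fixedSubmodule V A) with h | h
  · refine absurd ?_ hv0
    have : v ∈ fixedSubmodule V A := hv
    rwa [h, Submodule.mem_bot] at this
  · intro a ha w
    have : w ∈ fixedSubmodule V A := h ▸ Submodule.mem_top
    exact this a ha

variable (G V) in
/-- The derivations (crossed homomorphisms) from a group to a module over its group ring. -/
def derivations : Submodule (End (MonoidAlgebra ℤ G) V) (G → V) where
  carrier := {d | ∀ g h, d (g * h) = d g + of ℤ G g • d h}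
  zero_mem' g h := by simp
  add_mem' {d e} hd he g h := by simp only [Pi.add_apply, hd g h, he g h, smul_add]; abel
  smul_mem' f d hd g h := by
    simp only [Pi.smul_apply, hd g h, smul_add, End.smul_def, map_smul]

theorem map_one_of_mem {d : G → V} (hd : d ∈ derivations G V) : d 1 = 0 := by
  have := hd 1 1
  rwa [mul_one, of_one_smul, left_eq_add] at this

theorem map_inv_of_mem {d : G → V} (hd : d ∈ derivations G V) (g : G) :
    d g + of ℤ G g • d g⁻¹ = 0 := by
  rw [← hd, mul_inv_cancel, map_one_of_mem hd]

/-- The subgroup on which a derivation vanishes. -/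
def derivationKer {d : G → V} (hd : d ∈ derivations G V) : Subgroup G where
  carrier := {g | d g = 0}
  one_mem' := map_one_of_mem hd
  mul_mem' {g h} (hg : d g = 0) (hh : d h = 0) := by
    change d (g * h) = 0; rw [hd, hg, hh, smul_zero, add_zero]
  inv_mem' {g} (hg : d g = 0) := by
    have := map_inv_of_mem hd g
    rw [hg, zero_add] at this
    exact of_smul_eq_zero this

theorem map_mul_of_mem_actionKer {d : G → V} (hd : d ∈ derivations G V) {c : G}
    (hc : c ∈ actionKer G V) (g : G) : d (c * g) = d c + d g := by
  rw [hd, hc]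

/-- With `map_mul_of_mem_actionKer`, this makes a derivation an equivariant homomorphism on the
kernel of the action. -/
theorem map_conj_of_mem_actionKer {d : G → V} (hd : d ∈ derivations G V) {c : G}
    (hc : c ∈ actionKer G V) (g : G) : d (g * c * g⁻¹) = of ℤ G g • d c := by
  rw [mul_assoc, hd, hd, hc, smul_add, add_left_comm, map_inv_of_mem hd, add_zero]

variable (G V) in
/-- The subgroup of the kernel of the action on which all derivations vanish. -/
def crownKer : Subgroup G where
  carrier := {g | g ∈ actionKer G V ∧ ∀ d ∈ derivations G V, d g = 0}
  one_mem' := ⟨one_mem _, fun _ hd => map_one_of_mem hd⟩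
  mul_mem' hg hh := ⟨mul_mem hg.1 hh.1, fun d hd =>
    (derivationKer hd).mul_mem (hg.2 d hd) (hh.2 d hd)⟩
  inv_mem' hg := ⟨inv_mem hg.1, fun d hd => (derivationKer hd).inv_mem (hg.2 d hd)⟩

theorem map_eq_zero_of_mem_crownKer {d : G → V} (hd : d ∈ derivations G V) {g : G}
    (hg : g ∈ crownKer G V) : d g = 0 := hg.2 d hd

instance : (crownKer G V).Normal where
  conj_mem n hn g := ⟨Subgroup.Normal.conj_mem inferInstance n hn.1 g, fun d hd => by
    rw [map_conj_of_mem_actionKer hd hn.1, hn.2 d hd, smul_zero]⟩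

variable (V) in
/-- Two elements supplement `V` if no derivation into `V` that vanishes on both of them is nonzero
on the kernel of the action. -/
def Supplements (x y : G) : Prop :=
  ∀ d ∈ derivations G V, d x = 0 → d y = 0 → ∀ c ∈ actionKer G V, d c = 0

variable (V) in
/-- `V` occurs above the subgroup `S` if it is the image of a nonzero equivariant homomorphism from
a normal subgroup of `G` that vanishes on `S`. -/
def OccursAbove (S : Subgroup G) : Prop :=
  ∃ A : Subgroup G, A.Normal ∧ ∃ f : G → V, (∀ a ∈ A, ∀ b ∈ A, f (a * b) = f a + f b) ∧
    (∀ g, ∀ a ∈ A, f (g * a * g⁻¹) = of ℤ G g • f a) ∧ (∀ a ∈ A, a ∈ S → f a = 0) ∧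
    ∃ a ∈ A, f a ≠ 0

/-- Either the homomorphism already kills `A ⊓ S`, or its restriction to `A ⊓ S` is nonzero and
kills what lies in `T`. -/
theorem OccursAbove.of_inf {S T : Subgroup G} [S.Normal] (h : OccursAbove V (S ⊓ T)) :
    OccursAbove V S ∨ OccursAbove V T := by
  obtain ⟨A, hA, f, hmul, hconj, hker, a, ha, hfa⟩ := h
  by_cases h : ∀ b ∈ A, b ∈ S → f b = 0
  · exact Or.inl ⟨A, hA, f, hmul, hconj, h, a, ha, hfa⟩
  · push Not at h
    obtain ⟨b, hb, hbS, hfb⟩ := h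
    exact Or.inr ⟨A ⊓ S, inferInstance, f, fun a ha b hb => hmul a ha.1 b hb.1,
      fun g a ha => hconj g a ha.1, fun a ha haT => hker a ha.1 ⟨ha.2, haT⟩, b, ⟨hb, hbS⟩, hfb⟩

theorem OccursAbove.mono {S T : Subgroup G} (hST : S ≤ T) (h : OccursAbove V T) :
    OccursAbove V S := by
  obtain ⟨A, hA, f, hmul, hconj, hker, ha⟩ := h
  exact ⟨A, hA, f, hmul, hconj, fun a ha haS => hker a ha (hST haS), ha⟩

theorem occursAbove_of_derivation {S : Subgroup G} {d : G → V} (hd : d ∈ derivations G V)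
    (hS : ∀ c ∈ actionKer G V, c ∈ S → d c = 0) {c : G} (hc : c ∈ actionKer G V) (hdc : d c ≠ 0) :
    OccursAbove V S :=
  ⟨actionKer G V, inferInstance, d, fun _ ha b _ => map_mul_of_mem_actionKer hd ha b,
    fun g _ ha => map_conj_of_mem_actionKer hd ha g, hS, c, hc, hdc⟩

theorem not_occursAbove_top : ¬ OccursAbove V (⊤ : Subgroup G) := by
  rintro ⟨A, -, f, -, -, hker, a, ha, hfa⟩
  exact hfa (hker a ha trivial)

section Equiv

variable {W : Type*} [AddCommGroup W] [Module (MonoidAlgebra ℤ G) W]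

theorem comp_mem_derivations (e : V →ₗ[MonoidAlgebra ℤ G] W) {d : G → V}
    (hd : d ∈ derivations G V) : (fun g => e (d g)) ∈ derivations G W := fun g h => by
  simp only [hd g h, map_add, map_smul]

theorem actionKer_le_of_equiv (e : V ≃ₗ[MonoidAlgebra ℤ G] W) : actionKer G V ≤ actionKer G W := by
  intro g hg w
  rw [← e.apply_symm_apply w, ← map_smul, hg]

theorem crownKer_le_of_equiv (e : V ≃ₗ[MonoidAlgebra ℤ G] W) : crownKer G V ≤ crownKer G W :=
  fun g hg => ⟨actionKer_le_of_equiv e hg.1, fun d hd => e.symm.injective <| by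
    rw [map_zero]; exact hg.2 _ (comp_mem_derivations e.symm.toLinearMap hd)⟩

theorem Supplements.of_equiv (e : V ≃ₗ[MonoidAlgebra ℤ G] W) {x y : G} (h : Supplements V x y) :
    Supplements W x y := fun d hd hx hy c hc => e.symm.injective <| by
  rw [map_zero]
  exact h _ (comp_mem_derivations e.symm.toLinearMap hd) (by simp [hx]) (by simp [hy]) c
    (actionKer_le_of_equiv e.symm hc)

end Equiv

theorem supplements_of_le_crownKer {x y : G} (h : actionKer G V ≤ crownKer G V) :
    Supplements V x y := fun _ hd _ _ _ hc => (h hc).2 _ hd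

/-! ### Separation by endomorphisms and realization of derivation values. -/

/-- In a power of a simple module, a vector outside a submodule is separated from it by a linear
combination of the coordinates with coefficients in the endomorphism ring. -/
theorem _root_.Submodule.exists_sum_end_eq_zero {R M ι : Type*} [Ring R] [AddCommGroup M]
    [Module R M] [IsSimpleModule R M] [Fintype ι] {X : Submodule R (ι → M)} {h : ι → M}
    (hX : h ∉ X) : ∃ f : ι → End R M, (∀ x ∈ X, ∑ i, f i (x i) = 0) ∧ ∑ i, f i (h i) ≠ 0 := by
  classical
  obtain ⟨Y, hY⟩ := exists_isCompl X
  have hne : Y.projectionOnto X hY.symm h ≠ 0 := by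
    rwa [Ne, Submodule.projectionOnto_apply_eq_zero_iff]
  obtain ⟨j, hj⟩ : ∃ j, (Y.projectionOnto X hY.symm h : ι → M) j ≠ 0 := by
    by_contra! h0
    exact hne (Subtype.ext (funext h0))
  let φ : (ι → M) →ₗ[R] M := LinearMap.proj j ∘ₗ Y.subtype ∘ₗ Y.projectionOnto X hY.symm
  have hφ : ∀ y, ∑ i, φ (Pi.single i (y i)) = φ y := fun y => by
    rw [← map_sum, Finset.univ_sum_single]
  refine ⟨fun i => φ ∘ₗ LinearMap.single R (fun _ => M) i, fun x hx => ?_, ?_⟩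
  · refine (hφ x).trans ?_
    have : Y.projectionOnto X hY.symm x = 0 := by
      rwa [Submodule.projectionOnto_apply_eq_zero_iff]
    simp [φ, this]
  · exact fun h0 => hj ((hφ h).symm.trans h0)

/-- The vectors of values that all derivations take at the elements of a normal subgroup of the
kernel of the action. -/
noncomputable def valueSubmodule (A : Subgroup G) [A.Normal] (hA : A ≤ actionKer G V) :
    Submodule (MonoidAlgebra ℤ G) (derivations G V → V) :=
  AddSubgroup.toGroupRingSubmodule
    { carrier := {x | ∃ a ∈ A, ∀ d : derivations G V, x d = d.1 a}
      zero_mem' := ⟨1, one_mem _, fun d => (map_one_of_mem d.2).symm⟩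
      add_mem' := by
        rintro x y ⟨a, ha, hx⟩ ⟨b, hb, hy⟩
        exact ⟨a * b, mul_mem ha hb, fun d => by
          rw [map_mul_of_mem_actionKer d.2 (hA ha), Pi.add_apply, hx, hy]⟩
      neg_mem' := by
        rintro x ⟨a, ha, hx⟩
        exact ⟨a⁻¹, inv_mem ha, fun d => by
          have := map_mul_of_mem_actionKer d.2 (hA ha) a⁻¹
          rw [mul_inv_cancel, map_one_of_mem d.2] at this
          rw [Pi.neg_apply, hx, neg_eq_of_add_eq_zero_right this.symm]⟩ }
    (by
      rintro g x ⟨a, ha, hx⟩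
      exact ⟨g * a * g⁻¹, Subgroup.Normal.conj_mem ‹_› a ha g, fun d => by
        rw [map_conj_of_mem_actionKer d.2 (hA ha), Pi.smul_apply, hx]⟩)

/-- If `V` does not occur above `S`, then the values of the derivations at an element of `S` can be
prescribed, as far as this is compatible with linearity. -/
theorem exists_mem_forall_derivation_eq [Finite G] [Finite V] [IsSimpleModule (MonoidAlgebra ℤ G) V]
    {S : Subgroup G} [S.Normal] (hS : ¬ OccursAbove V S)
    (h : derivations G V →ₗ[End (MonoidAlgebra ℤ G) V] V)
    (h0 : ∀ d : derivations G V, (∀ c ∈ actionKer G V, d.1 c = 0) → h d = 0) :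
    ∃ s ∈ S, s ∈ actionKer G V ∧ ∀ d : derivations G V, d.1 s = h d := by
  have : Fintype (derivations G V) := Fintype.ofFinite _
  by_cases hmem : (h : derivations G V → V) ∈ valueSubmodule (S ⊓ actionKer G V) inf_le_right
  · obtain ⟨s, hs, hd⟩ := hmem
    exact ⟨s, hs.1, hs.2, fun d => (hd d).symm⟩
  -- Otherwise the vector `h` is separated from the attained values, and the separating combination
  -- is itself a derivation `e`. It kills `S ⊓ actionKer G V`, hence all of `actionKer G V` because
  -- `V` does not occur above `S`. Then `h e = 0`, contrary to separation.
  obtain ⟨f, hf, hfh⟩ := Submodule.exists_sum_end_eq_zero hmem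
  let e : derivations G V := ∑ d, f d • d
  have he : ∀ g, e.1 g = ∑ d, f d (d.1 g) := fun g => by
    simp [e, End.smul_def]
  refine absurd ?_ hfh
  have hhe : h e = ∑ d, f d (h d) := by
    simp [e, map_sum, End.smul_def]
  rw [← hhe]
  refine h0 e fun c hc => ?_
  by_contra hec
  refine hS (occursAbove_of_derivation e.2 (fun c hc hcS => ?_) hc hec)
  rw [he]
  exact hf (fun d => d.1 c) ⟨c, ⟨hcS, hc⟩, fun _ => rfl⟩

/-- Let `f : A → W` witness the occurrence. If `f` kills `A ⊓ actionKer G V`, it kills the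
commutators of `A` with `actionKer G V`, so the latter fixes a nonzero vector and acts trivially on
`W`. So does `A`, whence the inclusion is strict. If not, separation produces a derivation into `V`
that factors through `f` on `A ⊓ actionKer G V`; the induced nonzero map `W → V` is an isomorphism
by Schur's lemma. -/
theorem OccursAbove.equiv_or_lt [Finite G] [Finite V] [IsSimpleModule (MonoidAlgebra ℤ G) V]
    {W : Type*} [AddCommGroup W] [Module (MonoidAlgebra ℤ G) W]
    [IsSimpleModule (MonoidAlgebra ℤ G) W] (h : OccursAbove W (crownKer G V)) :
    Nonempty (V ≃ₗ[MonoidAlgebra ℤ G] W) ∨ actionKer G V < actionKer G W := by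
  obtain ⟨A, hA, f, hmul, hconj, hker, a, ha, hfa⟩ := h
  by_cases hC : ∀ b ∈ A, b ∈ actionKer G V → f b = 0
  · right
    have h1 : actionKer G V ≤ actionKer G W := le_actionKer_of_fixed hfa fun c hc => by
      rw [← hconj c a ha]
      have h2 : a * c⁻¹ * a⁻¹ ∈ actionKer G V :=
        Subgroup.Normal.conj_mem inferInstance _ (inv_mem hc) a
      have h3 : c * (a * c⁻¹ * a⁻¹) ∈ actionKer G V := mul_mem hc h2
      have h4 : c * (a * c⁻¹ * a⁻¹) ∈ A := by
        rw [show c * (a * c⁻¹ * a⁻¹) = c * a * c⁻¹ * a⁻¹ by group]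
        exact mul_mem (hA.conj_mem a ha c) (inv_mem ha)
      rw [show c * a * c⁻¹ = (c * (a * c⁻¹ * a⁻¹)) * a by group, hmul _ h4 _ ha, hC _ h4 h3, zero_add]
    have h2 : A ≤ actionKer G W := le_actionKer_of_fixed hfa fun b hb => by
      rw [← hconj b a ha]
      have h3 : b * a = (b * a * b⁻¹) * b := by group
      have h4 := hmul _ (hA.conj_mem a ha b) _ hb
      rw [← h3, hmul b hb a ha, add_comm] at h4
      exact (add_right_cancel h4).symm
    exact lt_of_le_of_ne h1 fun e => hfa (hC a ha (e ▸ h2 ha))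
  · left
    push Not at hC
    obtain ⟨b, hbA, hbC, hfb⟩ := hC
    have hf1 : f 1 = 0 := by
      have := hmul 1 (one_mem _) 1 (one_mem _)
      rwa [mul_one, left_eq_add] at this
    have hfinv : ∀ b ∈ A, f b⁻¹ = - f b := fun b hb => by
      have := hmul b hb b⁻¹ (inv_mem hb)
      rw [mul_inv_cancel, hf1] at this
      exact (neg_eq_of_add_eq_zero_right this.symm).symm
    let B : Subgroup G := A ⊓ actionKer G V
    let B₀ : Subgroup G :=
      { carrier := {b | b ∈ B ∧ f b = 0}
        one_mem' := ⟨one_mem _, hf1⟩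
        mul_mem' := fun ha hb =>
          ⟨mul_mem ha.1 hb.1, by rw [hmul _ ha.1.1 _ hb.1.1, ha.2, hb.2, add_zero]⟩
        inv_mem' := fun ha => ⟨inv_mem ha.1, by rw [hfinv _ ha.1.1, ha.2, neg_zero]⟩ }
    have hBn : B.Normal := inferInstance
    have : B₀.Normal := ⟨fun b hb g => ⟨hBn.conj_mem b hb.1 g, by
      rw [hconj g b hb.1.1, hb.2, smul_zero]⟩⟩
    have hB₀ : B₀ ≤ actionKer G V := fun b hb => hb.1.2
    have hdinv : ∀ d ∈ derivations G V, ∀ b ∈ B, d b⁻¹ = -d b := fun d hd b hb => by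
      have := map_mul_of_mem_actionKer hd hb.2 b⁻¹
      rw [mul_inv_cancel, map_one_of_mem hd] at this
      exact (neg_eq_of_add_eq_zero_right this.symm).symm
    have : Fintype (derivations G V) := Fintype.ofFinite _
    -- If `b₀ ∈ B₀` had the same derivation values as `b`, then `b * b₀⁻¹` would lie in the crown
    -- kernel, where `f` vanishes, although `f` takes the value `f b ≠ 0` there.
    have hmem : (fun d => d.1 b : derivations G V → V) ∉ valueSubmodule B₀ hB₀ := by
      rintro ⟨b₀, hb₀, hd⟩
      have h1 : b * b₀⁻¹ ∈ crownKer G V := ⟨mul_mem hbC (inv_mem (hB₀ hb₀)), fun d hd' => by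
        rw [map_mul_of_mem_actionKer hd' hbC, hdinv d hd' b₀ hb₀.1, add_neg_eq_zero]
        exact hd ⟨d, hd'⟩⟩
      have h2 := hker _ (mul_mem hbA (inv_mem hb₀.1.1)) h1
      rw [hmul _ hbA _ (inv_mem hb₀.1.1), hfinv _ hb₀.1.1, hb₀.2, neg_zero, add_zero] at h2
      exact hfb h2
    obtain ⟨c, hc, hcb⟩ := Submodule.exists_sum_end_eq_zero hmem
    obtain ⟨e, he, he'⟩ : ∃ e ∈ derivations G V, ∀ g, e g = ∑ d, c d (d.1 g) :=
      ⟨(∑ d, c d • d : derivations G V).1, Subtype.prop _, fun g => by simp [End.smul_def]⟩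
    have heb : e b ≠ 0 := by rwa [he']
    -- `e` factors through `f` on `B`
    have hfac : ∀ x ∈ B, ∀ y ∈ B, f x = f y → e x = e y := fun x hx y hy hxy => by
      have h1 : x * y⁻¹ ∈ B₀ := ⟨mul_mem hx (inv_mem hy), by
        rw [hmul _ hx.1 _ (inv_mem hy.1), hfinv _ hy.1, hxy, add_neg_cancel]⟩
      have h2 : e (x * y⁻¹) = 0 := by
        rw [he']
        exact hc (fun d => d.1 (x * y⁻¹)) ⟨_, h1, fun _ => rfl⟩
      rwa [map_mul_of_mem_actionKer he hx.2, hdinv e he y hy, add_neg_eq_zero] at h2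
    let X : Submodule (MonoidAlgebra ℤ G) W := AddSubgroup.toGroupRingSubmodule
      { carrier := {w | ∃ x ∈ B, f x = w}
        zero_mem' := ⟨1, one_mem _, hf1⟩
        add_mem' := by
          rintro _ _ ⟨x, hx, rfl⟩ ⟨y, hy, rfl⟩
          exact ⟨x * y, mul_mem hx hy, hmul _ hx.1 _ hy.1⟩
        neg_mem' := by
          rintro _ ⟨x, hx, rfl⟩
          exact ⟨x⁻¹, inv_mem hx, hfinv _ hx.1⟩ }
      (by
        rintro g _ ⟨x, hx, rfl⟩
        exact ⟨_, hBn.conj_mem x hx g, hconj g x hx.1⟩)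
    have hX : X = ⊤ := (eq_bot_or_eq_top X).resolve_left fun h0 => hfb <| by
      have : f b ∈ X := ⟨b, ⟨hbA, hbC⟩, rfl⟩
      rwa [h0, Submodule.mem_bot] at this
    have hsurj : ∀ w, ∃ x ∈ B, f x = w := fun w => by
      have : w ∈ X := hX ▸ Submodule.mem_top
      exact this
    choose s hs hfs using hsurj
    let φ : W →+ V := AddMonoidHom.mk' (fun w => e (s w)) fun v w => by
      rw [← map_mul_of_mem_actionKer he (hs v).2]
      exact hfac _ (hs _) _ (mul_mem (hs v) (hs w)) (by
        rw [hmul _ (hs v).1 _ (hs w).1, hfs, hfs, hfs])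
    let ψ : W →ₗ[MonoidAlgebra ℤ G] V :=
      equivariantOfLinearOfComm φ.toIntLinearMap fun g w => by
        change e (s (of ℤ G g • w)) = of ℤ G g • e (s w)
        rw [← map_conj_of_mem_actionKer he (hs w).2]
        exact hfac _ (hs _) _ (hBn.conj_mem _ (hs w) g) (by rw [hconj g _ (hs w).1, hfs, hfs])
    have hψ : ψ ≠ 0 := fun h0 => heb <| by
      have h1 : e (s (f b)) = 0 := congr($h0 (f b))
      rw [← h1]
      exact hfac _ ⟨hbA, hbC⟩ _ (hs _) (hfs _).symm
    exact ⟨(LinearEquiv.ofBijective ψ (ψ.bijective_or_eq_zero.resolve_right hψ)).symm⟩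

end GroupRingModule

/-! ### From maximal subgroups to derivations. -/

theorem Group.IsSolvable.exists_minimal_normal_not_le {G : Type*} [Group G] [Finite G]
    [Group.IsSolvable G] {M : Subgroup G} (hM : M ≠ ⊤) :
    ∃ A : Subgroup G, A.Normal ∧ ¬ A ≤ M ∧ (∀ a ∈ A, ∀ b ∈ A, a * b * a⁻¹ * b⁻¹ ∈ M) ∧
      ∀ B : Subgroup G, B.Normal → B < A → B ≤ M := by
  obtain ⟨A, ⟨hA, hAM⟩, hmin⟩ := (Set.toFinite {A : Subgroup G | A.Normal ∧ ¬ A ≤ M}).exists_minimal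
    ⟨⊤, inferInstance, fun h => hM (top_le_iff.1 h)⟩
  have hlt : ∀ B : Subgroup G, B.Normal → B < A → B ≤ M := fun B hB hBA => by
    by_contra hBM
    exact hBA.not_ge (hmin ⟨hB, hBM⟩ hBA.le)
  refine ⟨A, hA, hAM, fun a ha b hb => ?_, hlt⟩
  have h1 : ⁅A, A⁆ < A := Group.IsSolvable.commutator_lt_of_ne_bot fun h => hAM (h ▸ bot_le)
  exact hlt _ inferInstance h1 (Subgroup.commutator_mem_commutator ha hb)

namespace GroupRingModule

open MonoidAlgebra Module

universe u

/-- A proper subgroup of a finite soluble group is contained in the kernel of a derivation into a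
simple module that is nonzero on the kernel of the action. -/
theorem exists_derivation_of_ne_top {G : Type u} [Group G] [Finite G] [Group.IsSolvable G]
    {K : Subgroup G} (hK : K ≠ ⊤) :
    ∃ (V : Type u) (_ : AddCommGroup V) (_ : Module (MonoidAlgebra ℤ G) V),
      Finite V ∧ IsSimpleModule (MonoidAlgebra ℤ G) V ∧
      ∃ d ∈ derivations G V, (∀ k ∈ K, d k = 0) ∧ (∀ v, ∃ g, d g = v) ∧
        ∃ c ∈ actionKer G V, d c ≠ 0 := by
  obtain ⟨M, hM, hKM⟩ := (eq_top_or_exists_le_coatom K).resolve_left hK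
  obtain ⟨A, hA, hAM, hcomm, hmin⟩ := Group.IsSolvable.exists_minimal_normal_not_le hM.1
  have hsup : A ⊔ M = ⊤ := hM.2 _ (right_lt_sup.2 hAM)
  -- `M` normalizes the intersection because `A` is normal, and `A` does because commutators of `A`
  -- lie in `M`; together they generate `G`.
  have hN : (A ⊓ M).Normal := by
    rw [← Subgroup.normalizer_eq_top_iff, ← top_le_iff, ← hsup, sup_le_iff]
    constructor
    · intro a ha
      rw [Subgroup.mem_normalizer_iff]
      intro n
      have key : ∀ a ∈ A, ∀ n ∈ A ⊓ M, a * n * a⁻¹ ∈ A ⊓ M := fun a ha n hn => by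
        have h1 := mul_mem (hcomm a ha n hn.1) hn.2
        rw [inv_mul_cancel_right] at h1
        exact Subgroup.mem_inf.2 ⟨hA.conj_mem n hn.1 a, h1⟩
      refine ⟨key a ha n, fun h => ?_⟩
      have := key a⁻¹ (A.inv_mem ha) _ h
      simpa [mul_assoc] using this
    · intro m hm
      rw [Subgroup.mem_normalizer_iff]
      intro n
      have key : ∀ m ∈ M, ∀ n ∈ A ⊓ M, m * n * m⁻¹ ∈ A ⊓ M := fun m hm n hn =>
        Subgroup.mem_inf.2 ⟨hA.conj_mem n hn.1 m, M.mul_mem (M.mul_mem hm hn.2) (M.inv_mem hm)⟩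
      refine ⟨key m hm n, fun h => ?_⟩
      have := key m⁻¹ (M.inv_mem hm) _ h
      simpa [mul_assoc] using this
  let π := QuotientGroup.mk' (A ⊓ M)
  have hπ : ∀ x y : G, π x = π y ↔ x⁻¹ * y ∈ A ⊓ M := fun x y => QuotientGroup.eq
  let B : Subgroup (G ⧸ A ⊓ M) := A.map π
  have hB : B.Normal := hA.map π (QuotientGroup.mk'_surjective _)
  let _ : CommGroup B :=
    { (inferInstance : Group B) with
      mul_comm := by
        rintro ⟨_, a, ha, rfl⟩ ⟨_, b, hb, rfl⟩
        refine Subtype.ext ((map_mul π a b).symm.trans (Eq.trans ?_ (map_mul π b a)))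
        rw [hπ]
        refine Subgroup.mem_inf.2 ⟨A.mul_mem (A.inv_mem (mul_mem ha hb)) (mul_mem hb ha), ?_⟩
        have := hcomm b⁻¹ (inv_mem hb) a⁻¹ (inv_mem ha)
        simpa [mul_assoc] using this }
  let ρ : G →* AddMonoid.End (Additive B) :=
    { toFun := fun g => MonoidHom.toAdditive (MulAut.conjNormal (π g) : MulAut B).toMonoidHom
      map_one' := by ext x; simp; rfl
      map_mul' := fun g h => by ext x; simp; rfl }
  let _ : Module (MonoidAlgebra ℤ G) (Additive B) :=
    Module.compHom _ (MonoidAlgebra.lift ℤ (AddMonoid.End (Additive B)) G ρ).toRingHom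
  have hsmul : ∀ (g : G) (x : Additive B),
      ((of ℤ G g • x).toMul : G ⧸ A ⊓ M) = π g * x.toMul * (π g)⁻¹ := fun g x => by
    have : of ℤ G g • x = ρ g x := by
      change MonoidAlgebra.lift ℤ (AddMonoid.End (Additive B)) G ρ (of ℤ G g) x = _
      rw [MonoidAlgebra.lift_of]
    rw [this]
    exact MulAut.conjNormal_apply _ _
  have hfac : ∀ g, ∃ a ∈ A, ∃ m ∈ M, a * m = g := fun g =>
    Subgroup.mem_sup_of_normal_left.1 (hsup ▸ Subgroup.mem_top g)
  choose α hα μ hμ hαμ using hfac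
  -- The derivation is `am ↦ a`, well defined modulo `A ⊓ M`; its kernel is `M`.
  let d : G → Additive B := fun g => Additive.ofMul ⟨π (α g), Subgroup.mem_map_of_mem π (hα g)⟩
  have hd : ∀ a ∈ A, ∀ m ∈ M, ((d (a * m)).toMul : G ⧸ A ⊓ M) = π a := fun a ha m hm => by
    change π (α (a * m)) = π a
    rw [hπ]
    refine Subgroup.mem_inf.2 ⟨A.mul_mem (A.inv_mem (hα _)) ha, ?_⟩
    have h1 : (α (a * m))⁻¹ * a = μ (a * m) * m⁻¹ := by
      rw [inv_mul_eq_iff_eq_mul, ← mul_assoc, hαμ, mul_inv_cancel_right]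
    rw [h1]
    exact mul_mem (hμ _) (inv_mem hm)
  have hder : d ∈ derivations G (Additive B) := fun g h => by
    refine Additive.toMul.injective (Subtype.ext ?_)
    have h1 : g * h = (α g * (μ g * α h * (μ g)⁻¹)) * (μ g * μ h) := by
      conv_lhs => rw [← hαμ g, ← hαμ h]
      group
    change ((d (g * h)).toMul : G ⧸ A ⊓ M) = π (α g) * (of ℤ G g • d h).toMul
    rw [h1, hd _ (mul_mem (hα g) (hA.conj_mem _ (hα h) _)) _ (mul_mem (hμ g) (hμ h)), hsmul]
    change _ = π (α g) * (π g * π (α h) * (π g)⁻¹)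
    -- `A` acts trivially on `A/(A ⊓ M)`, so conjugation by `g` agrees there with conjugation by its
    -- `M`-part.
    have h2 : π g * π (α h) * (π g)⁻¹ = π (μ g * α h * (μ g)⁻¹) := by
      have h3 : g = α g * μ g := (hαμ g).symm
      rw [← map_mul, ← map_inv, ← map_mul, hπ]
      generalize hx : μ g * α h * (μ g)⁻¹ = x
      have hxA : x ∈ A := hx ▸ hA.conj_mem _ (hα h) _
      have h4 : g * α h * g⁻¹ = α g * x * (α g)⁻¹ := by
        rw [← hx]
        conv_lhs => rw [h3]
        group
      rw [h4]
      refine Subgroup.mem_inf.2 ⟨A.mul_mem (A.inv_mem (hA.conj_mem _ hxA _)) hxA, ?_⟩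
      have h5 := hcomm _ (hα g) x⁻¹ (inv_mem hxA)
      simpa [mul_assoc] using h5
    rw [h2, ← map_mul]
  have hd0 : ∀ g, d g = 0 ↔ g ∈ M := fun g => by
    have h1 : d g = 0 ↔ π 1 = π (α g) := by
      rw [map_one, eq_comm]
      exact ⟨fun h => congr(((Additive.toMul $h : B) : G ⧸ A ⊓ M)),
        fun h => Additive.toMul.injective (Subtype.ext h)⟩
    rw [h1, hπ, inv_one, one_mul]
    have h2 := Subgroup.mul_mem_cancel_right M (hμ g) (y := α g)
    rw [hαμ] at h2
    exact ⟨fun h => h2.2 h.2, fun h => ⟨hα g, h2.1 h⟩⟩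
  have hact : A ≤ actionKer G (Additive B) := fun a ha v => by
    refine Additive.toMul.injective (Subtype.ext ?_)
    rw [hsmul, mul_inv_eq_iff_eq_mul]
    exact congr((($(mul_comm (⟨π a, Subgroup.mem_map_of_mem π ha⟩ : B) v.toMul) : B) : G ⧸ A ⊓ M))
  have hsurj : ∀ v, ∃ a ∈ A, d a = v := by
    rintro ⟨_, a, ha, rfl⟩
    refine ⟨a, ha, Additive.toMul.injective (Subtype.ext ?_)⟩
    have := hd a ha 1 (one_mem M)
    rwa [mul_one] at this
  obtain ⟨c, hcA, hcM⟩ := SetLike.not_le_iff_exists.1 hAM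
  have hc0 : d c ≠ 0 := fun h => hcM ((hd0 c).1 h)
  refine ⟨Additive B, inferInstance, inferInstance, inferInstance, ?_, d, hder,
    fun k hk => (hd0 k).2 (hKM hk), fun v => (hsurj v).imp fun _ h => h.2, c, hact hcA, hc0⟩
  have : Nontrivial (Additive B) := ⟨d c, 0, hc0⟩
  refine { eq_bot_or_eq_top := fun P => ?_ }
  -- The preimage in `A` of a submodule is normal in `G`, so by minimality it is `A` or lies in `M`,
  -- where `d` vanishes.
  let A' : Subgroup G :=
    { carrier := {a | a ∈ A ∧ d a ∈ P}
      one_mem' := ⟨one_mem _, by rw [map_one_of_mem hder]; exact zero_mem P⟩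
      mul_mem' := fun ha hb => ⟨mul_mem ha.1 hb.1, by
        rw [map_mul_of_mem_actionKer hder (hact ha.1)]; exact add_mem ha.2 hb.2⟩
      inv_mem' := fun {a} ha => ⟨inv_mem ha.1, by
        have h := map_inv_of_mem hder a
        rw [hact ha.1] at h
        rw [← neg_eq_of_add_eq_zero_right h]
        exact neg_mem ha.2⟩ }
  have hA' : A'.Normal := ⟨fun a ha g => ⟨hA.conj_mem a ha.1 g, by
    rw [map_conj_of_mem_actionKer hder (hact ha.1)]; exact P.smul_mem _ ha.2⟩⟩
  rcases (show A' ≤ A from fun a ha => ha.1).eq_or_lt with h | h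
  · right
    refine eq_top_iff.2 fun v _ => ?_
    obtain ⟨a, ha, rfl⟩ := hsurj v
    rw [← h] at ha
    exact ha.2
  · left
    refine eq_bot_iff.2 fun v hv => ?_
    obtain ⟨a, ha, rfl⟩ := hsurj v
    exact (hd0 a).2 (hmin A' hA' h ⟨ha, hv⟩)

end GroupRingModule

/-! ### Derivations that vanish on the kernel of a nontrivial action are inner. -/

namespace GroupRingModule

open MonoidAlgebra Module

variable {G : Type*} [Group G] {V : Type*} [AddCommGroup V] [Module (MonoidAlgebra ℤ G) V]

/-- If a normal subgroup acts nontrivially on a simple module through an abelian quotient, then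
some element of its augmentation ideal acts as the identity. Hence derivations are inner on it. -/
theorem exists_inner_on_of_commute [Finite V] [IsSimpleModule (MonoidAlgebra ℤ G) V]
    {A : Subgroup G} [A.Normal] (hA : ¬ A ≤ actionKer G V)
    (hcomm : ∀ a ∈ A, ∀ b ∈ A, ∀ v : V, of ℤ G (a * b) • v = of ℤ G (b * a) • v) {d : G → V}
    (hd : d ∈ derivations G V) (hdcomm : ∀ a ∈ A, ∀ b ∈ A, d (a * b) = d (b * a)) :
    ∃ v, ∀ a ∈ A, d a = of ℤ G a • v - v := by
  let ρ : G → Module.End ℤ V := fun g => (DistribSMul.toAddMonoidHom V (of ℤ G g)).toIntLinearMap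
  have hρ : ∀ g v, ρ g v = of ℤ G g • v := fun _ _ => rfl
  let s : Set (Module.End ℤ V) := ρ '' A
  have hs : ∀ x ∈ s, ∀ y ∈ s, x * y = y * x := by
    rintro _ ⟨a, ha, rfl⟩ _ ⟨b, hb, rfl⟩
    ext v
    simpa only [Module.End.mul_apply, hρ, of_mul_smul] using hcomm a ha b hb v
  have hcs := Algebra.isMulCommutative_adjoin ℤ hs
  let _ : CommRing (Algebra.adjoin ℤ s) :=
    { (inferInstance : Ring (Algebra.adjoin ℤ s)) with mul_comm := hcs.is_comm.comm }
  let σ : A → Algebra.adjoin ℤ s := fun a => ⟨ρ a, Algebra.subset_adjoin ⟨a, a.2, rfl⟩⟩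
  have hσ : ∀ (a : A) (v : V), σ a • v = of ℤ G (a : G) • v := fun _ _ => rfl
  let I : Ideal (Algebra.adjoin ℤ s) := Ideal.span (Set.range fun a => σ a - 1)
  let W : Submodule (MonoidAlgebra ℤ G) V := AddSubgroup.toGroupRingSubmodule
    (AddSubgroup.closure {w | ∃ a ∈ A, ∃ v : V, w = of ℤ G a • v - v}) fun g w hw => by
      induction hw using AddSubgroup.closure_induction with
      | mem x hx =>
        obtain ⟨a, ha, v, rfl⟩ := hx
        refine AddSubgroup.subset_closure
          ⟨g * a * g⁻¹, Subgroup.Normal.conj_mem ‹_› a ha g, of ℤ G g • v, ?_⟩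
        rw [smul_sub, ← of_mul_smul, ← of_mul_smul, inv_mul_cancel_right]
      | zero => rw [smul_zero]; exact zero_mem _
      | add x y _ _ hx hy => rw [smul_add]; exact add_mem hx hy
      | neg x _ hx => rw [smul_neg]; exact neg_mem hx
  have hW : W = ⊤ := by
    refine (eq_bot_or_eq_top W).resolve_left fun h => hA fun a ha v => ?_
    have : of ℤ G a • v - v ∈ W := AddSubgroup.subset_closure ⟨a, ha, v, rfl⟩
    rwa [h, Submodule.mem_bot, sub_eq_zero] at this
  have hI : (⊤ : Submodule (Algebra.adjoin ℤ s) V) ≤ I • ⊤ := by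
    have h1 : AddSubgroup.closure {w | ∃ a ∈ A, ∃ v : V, w = of ℤ G a • v - v} ≤
        (I • (⊤ : Submodule (Algebra.adjoin ℤ s) V)).toAddSubgroup := by
      rw [AddSubgroup.closure_le]
      rintro _ ⟨a, ha, v, rfl⟩
      -- The differences `a • v - v` span `V` by simplicity, so `I • V = V`. Nakayama's lemma then
      -- gives `r` with `r - 1 ∈ I` killing `V`, and `1 - r` is the element of `I` acting as the
      -- identity.
      have : of ℤ G a • v - v = (σ ⟨a, ha⟩ - 1) • v := by rw [sub_smul, one_smul, hσ]
      rw [this]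
      exact Submodule.smul_mem_smul (Ideal.subset_span ⟨_, rfl⟩) trivial
    intro v _
    have h2 : v ∈ W := hW ▸ Submodule.mem_top
    exact h1 h2
  obtain ⟨r, hr, hr0⟩ := Submodule.exists_sub_one_mem_and_smul_eq_zero_of_fg_of_le_smul I ⊤
    (Module.Finite.fg_top) hI
  have hid : ∀ v : V, (1 - r) • v = v := fun v => by
    rw [sub_smul, one_smul, hr0 v trivial, sub_zero]
  -- For the generator `σ b - 1` take `v = d b`: expanding `d (a * b) = d (b * a)` gives `(b - 1) •
  -- d a = (a - 1) • d b`.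
  have key : ∀ φ ∈ I, ∃ v, ∀ a : A, φ • d a = σ a • v - v := by
    intro φ hφ
    induction hφ using Submodule.span_induction with
    | mem x hx =>
      obtain ⟨b, rfl⟩ := hx
      refine ⟨d b, fun a => ?_⟩
      have h1 := hdcomm a a.2 b b.2
      rw [hd, hd] at h1
      change (σ b - 1) • d a = _
      rw [sub_smul, one_smul, hσ, hσ, sub_eq_sub_iff_add_eq_add, add_comm, add_comm _ (d a), ← h1,
        add_comm]
    | zero => exact ⟨0, fun a => by simp⟩
    | add x y _ _ hx hy =>
      obtain ⟨v, hv⟩ := hx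
      obtain ⟨w, hw⟩ := hy
      exact ⟨v + w, fun a => by rw [add_smul, hv, hw, smul_add]; abel⟩
    | smul c x _ hx =>
      obtain ⟨v, hv⟩ := hx
      exact ⟨c • v, fun a => by
        rw [smul_assoc, hv, smul_sub, smul_smul, smul_smul, mul_comm]⟩
  obtain ⟨v, hv⟩ := key (1 - r) (by rw [← neg_sub]; exact neg_mem hr)
  exact ⟨v, fun a ha => by rw [← hid (d a)]; exact hv ⟨a, ha⟩⟩

theorem inner_mem_derivations (v : V) : (fun g => of ℤ G g • v - v) ∈ derivations G V :=
  fun g h => by simp only [of_mul_smul, smul_sub]; abel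

/-- A derivation into a nontrivial simple module for a finite soluble group is inner if it vanishes
on the kernel of the action. -/
theorem exists_inner [Finite G] [Group.IsSolvable G] [Finite V]
    [IsSimpleModule (MonoidAlgebra ℤ G) V] (hC : actionKer G V ≠ ⊤) {d : G → V}
    (hd : d ∈ derivations G V) (h0 : ∀ c ∈ actionKer G V, d c = 0) :
    ∃ v, ∀ g, d g = of ℤ G g • v - v := by
  obtain ⟨A, hA, hAC, hcomm, -⟩ := Group.IsSolvable.exists_minimal_normal_not_le hC
  have hswap : ∀ a b : G, b * a * ((b * a)⁻¹ * (a * b * a⁻¹ * b⁻¹) * (b * a)) = a * b :=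
    fun a b => by group
  have hC' : ∀ a ∈ A, ∀ b ∈ A, (b * a)⁻¹ * (a * b * a⁻¹ * b⁻¹) * (b * a) ∈ actionKer G V :=
    fun a ha b hb => by
      have := (inferInstance : (actionKer G V).Normal).conj_mem _ (hcomm a ha b hb) (b * a)⁻¹
      rwa [inv_inv] at this
  obtain ⟨v, hv⟩ := exists_inner_on_of_commute hAC (fun a ha b hb v => by
      rw [← hswap a b, of_mul_smul, hC' a ha b hb]) hd fun a ha b hb => by
    rw [← hswap a b, hd, h0 _ (hC' a ha b hb), smul_zero, add_zero]
  refine ⟨v, fun g => ?_⟩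
  -- The difference from the inner derivation vanishes on the normal subgroup `A`. Comparing `e (a *
  -- g)` with `e (g * (g⁻¹ * a * g))` shows that each value `e g` is fixed by `A`, hence zero.
  let e : derivations G V := ⟨d, hd⟩ - ⟨_, inner_mem_derivations v⟩
  have he : ∀ g, e.1 g = d g - (of ℤ G g • v - v) := fun _ => rfl
  rw [← sub_eq_zero, ← he]
  by_contra hne
  refine hAC (le_actionKer_of_fixed hne fun a ha => ?_)
  have h1 : ∀ a ∈ A, e.1 a = 0 := fun a ha => by rw [he, hv a ha, sub_self]
  have h2 : a * g = g * (g⁻¹ * a * g) := by group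
  have h3 : g⁻¹ * a * g ∈ A := by simpa using hA.conj_mem a ha g⁻¹
  have h4 := e.2 a g
  rw [h1 a ha, zero_add, h2, e.2, h1 _ h3, smul_zero, add_zero] at h4
  exact h4.symm

end GroupRingModule

/-! ### Correcting a path for a single simple module. -/

namespace GroupRingModule

open MonoidAlgebra Module

variable {G : Type*} [Group G]

section Lift

variable {V : Type*} [AddCommGroup V] [Module (MonoidAlgebra ℤ G) V]

theorem derivation_eq_zero {d : G → V} (hd : d ∈ derivations G V) {x y : G} {C : Subgroup G}
    (hC : Subgroup.closure {x, y} ⊔ C = ⊤) (hx : d x = 0) (hy : d y = 0)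
    (h0 : ∀ c ∈ C, d c = 0) (g : G) : d g = 0 := by
  have : Subgroup.closure {x, y} ⊔ C ≤ derivationKer hd := by
    rw [sup_le_iff, Subgroup.closure_le]
    refine ⟨?_, h0⟩
    rintro _ (rfl | rfl)
    · exact hx
    · exact hy
  exact this (hC ▸ Subgroup.mem_top g)

variable (V) in
/-- The evaluation of derivations at a group element. -/
noncomputable def evalDerivation (g : G) : derivations G V →ₗ[End (MonoidAlgebra ℤ G) V] V :=
  LinearMap.proj g ∘ₗ (derivations G V).subtype

theorem evalDerivation_apply (g : G) (d : derivations G V) : evalDerivation V g d = d.1 g := rfl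

variable (G V) in
/-- The derivations that vanish on the kernel of the action. -/
noncomputable def vanishingDerivations : Submodule (End (MonoidAlgebra ℤ G) V) (derivations G V) :=
  ⨅ c ∈ actionKer G V, LinearMap.ker (evalDerivation V c)

theorem mem_vanishingDerivations {d : derivations G V} :
    d ∈ vanishingDerivations G V ↔ ∀ c ∈ actionKer G V, d.1 c = 0 := by
  simp [vanishingDerivations, evalDerivation_apply]

variable (V) in
/-- The action of a group element, as a linear map over the endomorphism ring. -/
noncomputable def endLinearAction (g : G) : V →ₗ[End (MonoidAlgebra ℤ G) V] V where
  toFun v := of ℤ G g • v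
  map_add' := smul_add _
  map_smul' f _ := (f.map_smul _ _).symm

variable (G V) in
/-- The inner derivations. -/
noncomputable def innerDerivation : V →ₗ[End (MonoidAlgebra ℤ G) V] derivations G V where
  toFun v := ⟨fun g => of ℤ G g • v - v, inner_mem_derivations v⟩
  map_add' _ _ := Subtype.ext <| funext fun g => by
    simp only [smul_add, Submodule.coe_add, Pi.add_apply]; abel
  map_smul' f v := Subtype.ext <| funext fun g => by
    simp only [End.smul_def, RingHom.id_apply, Submodule.coe_smul, Pi.smul_apply, map_sub,
      map_smul]

variable [Finite G] [Finite V] [IsSimpleModule (MonoidAlgebra ℤ G) V]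

open Classical in
-- Multiplying `c` by elements of `S` changes its evaluation map into any linear map that agrees
-- with it on the vanishing derivations. Generation modulo `actionKer G V` says that on those
-- derivations consecutive kernels already meet trivially, so the linear extension result applies.
theorem exists_path_lift [Group.IsSolvable G] {S : Subgroup G} [S.Normal]
    (hS : ¬ OccursAbove V S) {a₁ b₁ a₂ b₂ c₁ c₂ : G} (h₁ : Subgroup.closure {a₁, b₁} = ⊤)
    (h₂ : Subgroup.closure {a₂, b₂} = ⊤) (hc₁ : Subgroup.closure {a₁, c₁} ⊔ actionKer G V = ⊤)
    (hc : Subgroup.closure {c₁, c₂} ⊔ actionKer G V = ⊤)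
    (hc₂ : Subgroup.closure {c₂, a₂} ⊔ actionKer G V = ⊤) :
    ∃ s₁ ∈ S, ∃ s₂ ∈ S, Supplements V a₁ (c₁ * s₁) ∧ Supplements V (c₁ * s₁) (c₂ * s₂) ∧
      Supplements V (c₂ * s₂) a₂ := by
  have : Module.Finite (End (MonoidAlgebra ℤ G) V) V := inferInstance
  have : Module.Finite (End (MonoidAlgebra ℤ G) V) (derivations G V) := inferInstance
  have hVnt : Nontrivial V := IsSimpleModule.nontrivial (MonoidAlgebra ℤ G) V
  have hinj : ∀ {a b : G}, Subgroup.closure {a, b} = ⊤ → ∀ d : derivations G V, d.1 a = 0 →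
      d.1 b = 0 → d = 0 := fun h d ha hb => Subtype.ext <| funext <|
    derivation_eq_zero d.2 (C := ⊥) (by rw [h, top_sup_eq]) ha hb fun c hc => by
      rw [Subgroup.mem_bot.1 hc, map_one_of_mem d.2]
  have hZ : finrank (End (MonoidAlgebra ℤ G) V) (derivations G V) ≤
      2 * finrank (End (MonoidAlgebra ℤ G) V) V := by
    have : Function.Injective ((evalDerivation V a₁).prod (evalDerivation V b₁)) := by
      rw [injective_iff_map_eq_zero]
      intro d hd
      exact hinj h₁ d congr($hd.1) congr($hd.2)
    have := LinearMap.finrank_le_finrank_of_injective this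
    rw [finrank_prod] at this
    omega
  have hker : ∀ {a b : G}, Subgroup.closure {a, b} = ⊤ →
      finrank (End (MonoidAlgebra ℤ G) V) (LinearMap.ker (evalDerivation V a)) ≤
        finrank (End (MonoidAlgebra ℤ G) V) V := fun {a b} h => by
    have : Function.Injective (evalDerivation V b ∘ₗ (LinearMap.ker (evalDerivation V a)).subtype)
        := by
      rw [injective_iff_map_eq_zero]
      intro d hd
      exact Subtype.ext (hinj h d.1 d.2 hd)
    exact LinearMap.finrank_le_finrank_of_injective this
  have hvan : ∀ {x y : G}, Subgroup.closure {x, y} ⊔ actionKer G V = ⊤ →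
      ∀ d ∈ vanishingDerivations G V, d.1 x = 0 → d.1 y = 0 → d = 0 := fun h d hd hx hy =>
    Subtype.ext <| funext <| derivation_eq_zero d.2 h hx hy (mem_vanishingDerivations.1 hd)
  obtain ⟨hZ₀, hn⟩ : finrank (End (MonoidAlgebra ℤ G) V) (vanishingDerivations G V) ≤
      finrank (End (MonoidAlgebra ℤ G) V) V ∧
      (finrank (End (MonoidAlgebra ℤ G) V) (vanishingDerivations G V) <
        finrank (End (MonoidAlgebra ℤ G) V) V ∨ 2 ≤ finrank (End (MonoidAlgebra ℤ G) V) V ∨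
        ∃ μ : End (MonoidAlgebra ℤ G) V, μ ≠ 0 ∧ μ ≠ 1) := by
    by_cases hC : actionKer G V = ⊤
    · have : vanishingDerivations G V = ⊥ := eq_bot_iff.2 fun d hd => by
        refine (Submodule.mem_bot _).2 (Subtype.ext (funext fun g => ?_))
        exact mem_vanishingDerivations.1 hd g (hC ▸ Subgroup.mem_top g)
      rw [this, finrank_bot]
      exact ⟨Nat.zero_le _, Or.inl finrank_pos⟩
    · constructor
      · have : vanishingDerivations G V ≤ LinearMap.range (innerDerivation G V) := fun d hd => by
          obtain ⟨v, hv⟩ := exists_inner hC d.2 (mem_vanishingDerivations.1 hd)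
          exact ⟨v, Subtype.ext (funext fun g => (hv g).symm)⟩
        exact (Submodule.finrank_mono this).trans (LinearMap.finrank_range_le _)
      -- A one-dimensional space over an endomorphism ring with only `0` and `1` has just two
      -- vectors, so `G` acts trivially, which is excluded here.
      · right
        by_contra! hcon
        obtain ⟨v₀, hv₀⟩ := finrank_le_one_iff.1 (Nat.le_of_lt_succ hcon.1)
        have h01 : ∀ w : V, w = 0 ∨ w = v₀ := fun w => by
          obtain ⟨c, rfl⟩ := hv₀ w
          rcases eq_or_ne c 0 with rfl | hc
          · left; rw [zero_smul]
          · right; rw [hcon.2 c hc, one_smul]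
        refine hC (eq_top_iff.2 fun g _ w => ?_)
        rcases h01 w with rfl | rfl
        · rw [smul_zero]
        · rcases h01 (of ℤ G g • w) with h | h
          · rw [h, of_smul_eq_zero h]
          · exact h
  obtain ⟨g₁, g₂, hg₁, hg₂, k₁, k, k₂⟩ := LinearMap.exists_path_extension
    (Z₀ := vanishingDerivations G V) (evalDerivation V a₁) (evalDerivation V a₂)
    (evalDerivation V c₁) (evalDerivation V c₂) hZ hZ₀ (hker h₁) (hker h₂) (hvan hc₁) (hvan hc)
    (hvan hc₂) hn
  have lift : ∀ (c : G) (g : derivations G V →ₗ[End (MonoidAlgebra ℤ G) V] V),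
      (∀ d ∈ vanishingDerivations G V, g d = evalDerivation V c d) →
      ∃ s ∈ S, ∀ d : derivations G V, d.1 (c * s) = g d := by
    intro c g hg
    -- Since `d (c * s) = d c + c • d s`, the value required of `d` at `s` is `c⁻¹ • (g d - d c)`.
    obtain ⟨s, hsS, -, hs⟩ := exists_mem_forall_derivation_eq hS
      (endLinearAction V c⁻¹ ∘ₗ (g - evalDerivation V c)) fun d hd => by
        rw [LinearMap.comp_apply, LinearMap.sub_apply, hg d (mem_vanishingDerivations.2 hd),
          sub_self, map_zero]
    refine ⟨s, hsS, fun d => ?_⟩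
    rw [d.2, hs d]
    change d.1 c + of ℤ G c • of ℤ G c⁻¹ • (g d - d.1 c) = g d
    rw [of_smul_inv_smul, add_sub_cancel]
  obtain ⟨s₁, hs₁, hs₁'⟩ := lift c₁ g₁ hg₁
  obtain ⟨s₂, hs₂, hs₂'⟩ := lift c₂ g₂ hg₂
  refine ⟨s₁, hs₁, s₂, hs₂, fun d hd hx hy c _ => ?_, fun d hd hx hy c _ => ?_,
    fun d hd hx hy c _ => ?_⟩
  · exact congr(($(k₁ ⟨d, hd⟩ hx ((hs₁' _).symm.trans hy))).1 c)
  · exact congr(($(k ⟨d, hd⟩ ((hs₁' _).symm.trans hx) ((hs₂' _).symm.trans hy))).1 c)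
  · exact congr(($(k₂ ⟨d, hd⟩ ((hs₂' _).symm.trans hx) hy)).1 c)

end Lift

end GroupRingModule

/-! ### Descent through normal subgroups. -/

namespace GroupRingModule

open MonoidAlgebra Module

universe u

section

variable {G : Type*} [Group G] {V : Type*} [AddCommGroup V] [Module (MonoidAlgebra ℤ G) V]

theorem map_mul_of_mem_crownKer {d : G → V} (hd : d ∈ derivations G V) (x : G) {s : G}
    (hs : s ∈ crownKer G V) : d (x * s) = d x := by
  rw [hd, map_eq_zero_of_mem_crownKer hd hs, smul_zero, add_zero]

theorem Supplements.mul_right {x y s t : G} (h : Supplements V x y) (hs : s ∈ crownKer G V)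
    (ht : t ∈ crownKer G V) : Supplements V (x * s) (y * t) := fun d hd hx hy => by
  rw [map_mul_of_mem_crownKer hd x hs] at hx
  rw [map_mul_of_mem_crownKer hd y ht] at hy
  exact h d hd hx hy

end

variable {G : Type u} [Group G]

/-- A pair of elements supplements every simple module whose crown kernel contains `S`. -/
def SupplementsAbove (S : Subgroup G) (x y : G) : Prop :=
  ∀ (V : Type u) [AddCommGroup V] [Module (MonoidAlgebra ℤ G) V] [Finite V]
    [IsSimpleModule (MonoidAlgebra ℤ G) V], S ≤ crownKer G V → Supplements V x y

theorem SupplementsAbove.closure_eq_top [Finite G] [Group.IsSolvable G] {x y : G}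
    (h : SupplementsAbove ⊥ x y) : Subgroup.closure {x, y} = ⊤ := by
  by_contra hne
  obtain ⟨V, _, _, _, _, d, hd, hK, -, c, hc, hdc⟩ := exists_derivation_of_ne_top hne
  exact hdc (h V bot_le d hd (hK _ (Subgroup.subset_closure (by simp)))
    (hK _ (Subgroup.subset_closure (by simp))) c hc)

/-- If the join were proper, some derivation onto a simple `W` would kill it. Killing the normal
subgroup `actionKer G V` and being surjective, it forces that subgroup to act trivially on `W`,
properly inside `actionKer G W`. So `W` is among the modules already supplemented, a contradiction.
-/
theorem SupplementsAbove.closure_sup_actionKer_eq_top [Finite G] [Group.IsSolvable G]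
    {S : Subgroup G} {x y : G} (h : SupplementsAbove S x y) {V : Type u} [AddCommGroup V]
    [Module (MonoidAlgebra ℤ G) V]
    (hV : ∀ (W : Type u) [AddCommGroup W] [Module (MonoidAlgebra ℤ G) W] [Finite W]
      [IsSimpleModule (MonoidAlgebra ℤ G) W], actionKer G V < actionKer G W → S ≤ crownKer G W) :
    Subgroup.closure {x, y} ⊔ actionKer G V = ⊤ := by
  by_contra hne
  obtain ⟨W, _, _, _, _, d, hd, hK, hsurj, c, hc, hdc⟩ := exists_derivation_of_ne_top hne
  have hdV : ∀ g ∈ actionKer G V, d g = 0 := fun g hg => hK g (Subgroup.mem_sup_right hg)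
  have hle : actionKer G V ≤ actionKer G W := fun g hg w => by
    obtain ⟨k, rfl⟩ := hsurj w
    have h1 : k⁻¹ * g * k ∈ actionKer G V := by
      simpa using (inferInstance : (actionKer G V).Normal).conj_mem g hg k⁻¹
    have h2 := hd g k
    rw [show g * k = k * (k⁻¹ * g * k) by group, hd, hdV _ h1, hdV _ hg, smul_zero, add_zero,
      zero_add] at h2
    exact h2.symm
  have hlt : actionKer G V < actionKer G W := lt_of_le_of_ne hle fun e => hdc (hdV c (e ▸ hc))
  exact hdc (h W (hV W hlt) d hd (hK _ (Subgroup.mem_sup_left (Subgroup.subset_closure (by simp))))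
    (hK _ (Subgroup.mem_sup_left (Subgroup.subset_closure (by simp)))) c hc)

/-- The invariant `hS` says that a module occurring above `S` has been fully dealt with. Hence a
module whose crown kernel does not contain `S` does not occur above `S`, and its derivation values
can be adjusted inside `S`. Choosing its action kernel maximal supplies generation modulo that
kernel. -/
theorem exists_path_above_bot [Finite G] [Group.IsSolvable G] {a₁ b₁ a₂ b₂ : G}
    (h₁ : Subgroup.closure {a₁, b₁} = ⊤) (h₂ : Subgroup.closure {a₂, b₂} = ⊤) (S : Subgroup G)
    (hSn : S.Normal)
    (hS : ∀ (V : Type u) [AddCommGroup V] [Module (MonoidAlgebra ℤ G) V] [Finite V]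
      [IsSimpleModule (MonoidAlgebra ℤ G) V], OccursAbove V S → S ≤ crownKer G V)
    (hpath : ∃ c₁ c₂, SupplementsAbove S a₁ c₁ ∧ SupplementsAbove S c₁ c₂ ∧
      SupplementsAbove S c₂ a₂) :
    ∃ c₁ c₂, SupplementsAbove ⊥ a₁ c₁ ∧ SupplementsAbove ⊥ c₁ c₂ ∧ SupplementsAbove ⊥ c₂ a₂ := by
  induction S using WellFoundedLT.induction with
  | _ S ih =>
  let 𝒞 : Set (Subgroup G) := {C | ∃ (V : Type u) (_ : AddCommGroup V)
    (_ : Module (MonoidAlgebra ℤ G) V), Finite V ∧ IsSimpleModule (MonoidAlgebra ℤ G) V ∧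
      ¬ S ≤ crownKer G V ∧ actionKer G V = C}
  rcases 𝒞.eq_empty_or_nonempty with hempty | hne
  · have hall : ∀ (V : Type u) [AddCommGroup V] [Module (MonoidAlgebra ℤ G) V] [Finite V]
        [IsSimpleModule (MonoidAlgebra ℤ G) V], S ≤ crownKer G V := fun V _ _ _ _ => by
      by_contra hV
      have : actionKer G V ∈ 𝒞 := ⟨V, _, _, inferInstance, inferInstance, hV, rfl⟩
      simp [hempty] at this
    obtain ⟨c₁, c₂, k₁, k, k₂⟩ := hpath
    exact ⟨c₁, c₂, fun V _ _ _ _ _ => k₁ V (hall V), fun V _ _ _ _ _ => k V (hall V),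
      fun V _ _ _ _ _ => k₂ V (hall V)⟩
  obtain ⟨_, ⟨V, _, _, _, _, hVS, rfl⟩, hmax⟩ := (Set.toFinite 𝒞).exists_maximal hne
  have hgt : ∀ (W : Type u) [AddCommGroup W] [Module (MonoidAlgebra ℤ G) W] [Finite W]
      [IsSimpleModule (MonoidAlgebra ℤ G) W], actionKer G V < actionKer G W → S ≤ crownKer G W :=
    fun W _ _ _ _ hlt => by
      by_contra hW
      exact hlt.not_ge (hmax ⟨W, _, _, inferInstance, inferInstance, hW, rfl⟩ hlt.le)
  obtain ⟨c₁, c₂, k₁, k, k₂⟩ := hpath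
  obtain ⟨s₁, hs₁, s₂, hs₂, l₁, l, l₂⟩ := exists_path_lift (V := V) (fun h => hVS (hS V h)) h₁ h₂
    (k₁.closure_sup_actionKer_eq_top hgt) (k.closure_sup_actionKer_eq_top hgt)
    (k₂.closure_sup_actionKer_eq_top hgt)
  -- Passing to `S ⊓ crownKer G V` brings in no new module except copies of `V`: one with larger
  -- action kernel has `S` in its crown kernel by the maximal choice.
  have hcases : ∀ (W : Type u) [AddCommGroup W] [Module (MonoidAlgebra ℤ G) W] [Finite W]
      [IsSimpleModule (MonoidAlgebra ℤ G) W], OccursAbove W (S ⊓ crownKer G V) →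
      S ≤ crownKer G W ∨ Nonempty (V ≃ₗ[MonoidAlgebra ℤ G] W) := fun W _ _ _ _ hW => by
    rcases hW.of_inf with h | h
    · exact Or.inl (hS W h)
    · exact h.equiv_or_lt.symm.imp_left (hgt W)
  have habove : ∀ {x y s t : G}, s ∈ S → t ∈ S → SupplementsAbove S x y →
      Supplements V (x * s) (y * t) → SupplementsAbove (S ⊓ crownKer G V) (x * s) (y * t) :=
    fun {x y s t} hs ht h hV W _ _ _ _ hW => by
      by_cases hocc : OccursAbove W (S ⊓ crownKer G V)
      · rcases hcases W hocc with h' | ⟨⟨e⟩⟩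
        · exact (h W h').mul_right (h' hs) (h' ht)
        · exact hV.of_equiv e
      -- A module not occurring above the new subgroup imposes no condition: a derivation nonzero on
      -- its action kernel would make it occur above its crown kernel, hence above the smaller
      -- subgroup.
      · refine supplements_of_le_crownKer fun c hc => ⟨hc, fun d hd => ?_⟩
        by_contra hdc
        exact hocc ((occursAbove_of_derivation hd
          (fun c _ hc => map_eq_zero_of_mem_crownKer hd hc) hc hdc).mono hW)
  refine ih (S ⊓ crownKer G V) (lt_of_le_of_ne inf_le_left fun h => hVS (inf_eq_left.1 h))
    inferInstance
    (fun W _ _ _ _ hW => ?_) ⟨c₁ * s₁, c₂ * s₂, ?_, habove hs₁ hs₂ k l, ?_⟩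
  · rcases hcases W hW with h | ⟨⟨e⟩⟩
    · exact inf_le_left.trans h
    · exact inf_le_right.trans (crownKer_le_of_equiv e)
  · have := habove (one_mem S) hs₁ k₁ (by rwa [mul_one])
    rwa [mul_one] at this
  · have := habove hs₂ (one_mem S) k₂ (by rwa [mul_one])
    rwa [mul_one] at this

end GroupRingModule

theorem Group.IsSolvable.exists_generating_path {G : Type*} [Group G] [Finite G]
    [Group.IsSolvable G] {a₁ b₁ a₂ b₂ : G} (h₁ : Subgroup.closure {a₁, b₁} = ⊤)
    (h₂ : Subgroup.closure {a₂, b₂} = ⊤) :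
    ∃ c₁ c₂ : G, Subgroup.closure {a₁, c₁} = ⊤ ∧ Subgroup.closure {c₁, c₂} = ⊤ ∧
      Subgroup.closure {c₂, a₂} = ⊤ := by
  open GroupRingModule in
  have htop : ∀ x y : G, SupplementsAbove ⊤ x y := fun x y V _ _ _ _ hV =>
    supplements_of_le_crownKer (le_top.trans hV)
  obtain ⟨c₁, c₂, k₁, k, k₂⟩ := GroupRingModule.exists_path_above_bot h₁ h₂ ⊤ inferInstance
    (fun V _ _ _ _ h => absurd h GroupRingModule.not_occursAbove_top)
    -- Above `⊤` every pair supplements, since all derivations in question vanish; any start would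
    -- do.
    ⟨1, 1, htop _ _, htop _ _, htop _ _⟩
  exact ⟨c₁, c₂, k₁.closure_eq_top, k.closure_eq_top, k₂.closure_eq_top⟩

/-! ### Translation to the generating graph. -/

section GeneratingGraph

variable {G : Type*} [Group G]

theorem closure_pair_eq_top_of_closure_pair_one {a : G} (h : Subgroup.closure {a, 1} = ⊤) (b : G) :
    Subgroup.closure {a, b} = ⊤ := by
  rw [← top_le_iff, ← h, Subgroup.closure_le]
  rintro _ (rfl | rfl)
  · exact Subgroup.subset_closure (by simp)
  · exact one_mem _

theorem mem_support_generatingGraph {a b : G} (ha : a ≠ 1) (hb : b ≠ 1) (hab : a ≠ b)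
    (h : Subgroup.closure {a, b} = ⊤) : (⟨a, ha⟩ : {g : G // g ≠ 1}) ∈ (generatingGraph G).support :=
  ⟨⟨b, hb⟩, fun e => hab congr(($e).1), h⟩

theorem edist_nonIsolatedGeneratingGraph_le_one {a b : {g : G // g ≠ 1}}
    (ha : a ∈ (generatingGraph G).support) (hb : b ∈ (generatingGraph G).support)
    (h : Subgroup.closure {(a : G), (b : G)} = ⊤) :
    (nonIsolatedGeneratingGraph G).edist ⟨a, ha⟩ ⟨b, hb⟩ ≤ 1 := by
  by_cases hab : a = b
  · subst hab
    rw [SimpleGraph.edist_self]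
    exact zero_le_one
  · refine (SimpleGraph.edist_eq_one_iff_adj.2 ?_).le
    exact ⟨hab, h⟩

/-- The elements `c₁, c₂` may be trivial or coincide with their neighbours. If one is `1`, then `a₁`
or `a₂` alone generates `G` and the endpoints are equal or adjacent; coincidences only shorten the
path. -/
theorem edist_nonIsolatedGeneratingGraph_le_three [Finite G] [Group.IsSolvable G]
    (x y : (generatingGraph G).support) : (nonIsolatedGeneratingGraph G).edist x y ≤ 3 := by
  obtain ⟨⟨a₁, ha₁⟩, hx⟩ := x
  obtain ⟨⟨a₂, ha₂⟩, hy⟩ := y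
  obtain ⟨⟨b₁, hb₁⟩, -, h₁⟩ := id hx
  obtain ⟨⟨b₂, hb₂⟩, -, h₂⟩ := id hy
  obtain ⟨c₁, c₂, k₁, k, k₂⟩ := Group.IsSolvable.exists_generating_path h₁ h₂
  have h13 : (1 : ℕ∞) ≤ 3 := by norm_num
  by_cases hc₁ : c₁ = 1
  · subst hc₁
    exact (edist_nonIsolatedGeneratingGraph_le_one hx hy
      (closure_pair_eq_top_of_closure_pair_one k₁ a₂)).trans h13
  by_cases hc₂ : c₂ = 1
  · subst hc₂
    refine (edist_nonIsolatedGeneratingGraph_le_one hx hy ?_).trans h13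
    rw [Set.pair_comm] at k₂ ⊢
    exact closure_pair_eq_top_of_closure_pair_one k₂ a₁
  have hv₁ : (⟨c₁, hc₁⟩ : {g : G // g ≠ 1}) ∈ (generatingGraph G).support := by
    by_cases h : c₁ = a₁
    · subst h; exact hx
    · exact mem_support_generatingGraph hc₁ ha₁ h (by rwa [Set.pair_comm])
  have hv₂ : (⟨c₂, hc₂⟩ : {g : G // g ≠ 1}) ∈ (generatingGraph G).support := by
    by_cases h : c₂ = a₂
    · subst h; exact hy
    · exact mem_support_generatingGraph hc₂ ha₂ h k₂
  calc (nonIsolatedGeneratingGraph G).edist ⟨⟨a₁, ha₁⟩, hx⟩ ⟨⟨a₂, ha₂⟩, hy⟩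
      ≤ (nonIsolatedGeneratingGraph G).edist ⟨⟨a₁, ha₁⟩, hx⟩ ⟨⟨c₁, hc₁⟩, hv₁⟩ +
        ((nonIsolatedGeneratingGraph G).edist ⟨⟨c₁, hc₁⟩, hv₁⟩ ⟨⟨c₂, hc₂⟩, hv₂⟩ +
          (nonIsolatedGeneratingGraph G).edist ⟨⟨c₂, hc₂⟩, hv₂⟩ ⟨⟨a₂, ha₂⟩, hy⟩) :=
        SimpleGraph.edist_triangle.trans (add_le_add_right SimpleGraph.edist_triangle _)
    _ ≤ 1 + (1 + 1) := add_le_add (edist_nonIsolatedGeneratingGraph_le_one hx hv₁ k₁)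
        (add_le_add (edist_nonIsolatedGeneratingGraph_le_one hv₁ hv₂ k)
          (edist_nonIsolatedGeneratingGraph_le_one hv₂ hy k₂))
    _ = 3 := by norm_num

/-- When one element `g` generates `G`, an edge needs a third element besides `g` and `1`; this is
where the order enters. -/
theorem nonempty_support_generatingGraph (hG : IsTwoGenerated G) (hcard : 2 < Nat.card G) :
    (generatingGraph G).support.Nonempty := by
  obtain ⟨a, b, hab⟩ := hG
  have cyclic : ∀ g : G, Subgroup.closure {g, 1} = ⊤ → (generatingGraph G).support.Nonempty := by
    intro g hg
    have hg1 : g ≠ 1 := by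
      rintro rfl
      have h1 : (⊤ : Subgroup G) = ⊥ := by rw [← hg]; simp
      have h2 : Nat.card (⊤ : Subgroup G) = 1 := by rw [h1]; simp
      rw [Subgroup.card_top] at h2
      omega
    obtain ⟨h, hh⟩ : ∃ h, h ∉ ({g, 1} : Set G) := by
      by_contra! hall
      have h1 : ({g, 1} : Set G) = Set.univ := Set.eq_univ_of_forall hall
      have h3 := Set.ncard_insert_le g ({1} : Set G)
      rw [h1, Set.ncard_univ, Set.ncard_singleton] at h3
      omega
    rw [Set.mem_insert_iff, not_or] at hh
    exact ⟨_, mem_support_generatingGraph hg1 hh.2 (Ne.symm hh.1)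
      (closure_pair_eq_top_of_closure_pair_one hg h)⟩
  by_cases ha : a = 1
  · subst ha
    exact cyclic b (by rwa [Set.pair_comm])
  by_cases hb : b = 1
  · subst hb
    exact cyclic a hab
  by_cases h : a = b
  · subst h
    refine cyclic a (top_le_iff.1 (hab.ge.trans (Subgroup.closure_mono ?_)))
    simp
  · exact ⟨_, mem_support_generatingGraph ha hb h hab⟩

end GeneratingGraph

theorem theorem1p1 (G : Type*) [Group G] [Finite G] [Group.IsSolvable G] (hG : IsTwoGenerated G) :
    (nonIsolatedGeneratingGraph G).Preconnected ∧
    (2 < Nat.card G → (nonIsolatedGeneratingGraph G).Connected) ∧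
    (nonIsolatedGeneratingGraph G).ediam ≤ 3 ∧
    ∀ a₁ b₁ a₂ b₂ : G,
      Subgroup.closure {a₁, b₁} = ⊤ → Subgroup.closure {a₂, b₂} = ⊤ →
      ∃ c₁ c₂ : G, Subgroup.closure {a₁, c₁} = ⊤ ∧ Subgroup.closure {c₁, c₂} = ⊤ ∧
        Subgroup.closure {c₂, a₂} = ⊤ := by
  have hpre : (nonIsolatedGeneratingGraph G).Preconnected := fun x y => by
    rw [← SimpleGraph.edist_ne_top_iff_reachable]
    exact ne_top_of_le_ne_top (by decide) (edist_nonIsolatedGeneratingGraph_le_three x y)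
  refine ⟨hpre, fun hcard => ?_, SimpleGraph.ediam_le_iff.2
    edist_nonIsolatedGeneratingGraph_le_three,
    fun _ _ _ _ h₁ h₂ => Group.IsSolvable.exists_generating_path h₁ h₂⟩
  have := (nonempty_support_generatingGraph hG hcard).to_subtype
  exact ⟨hpre⟩
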